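/- Let $d\ge 2$ and $0<s<\frac d2$. For $\alpha\in(0,d)$ let $I_\alpha(x)=A_\alpha|x|^{\alpha-d}$, $A_\alpha=\frac{\Gamma((d-\alpha)/2)}{\pi^{d/2}2^{\alpha}\Gamma(\alpha/2)}$, be the Riesz kernel on $\mathbb R^d$, and let $$\mathcal D_{2s}(f,f)=\int_{\mathbb R^d}(I_{2s}*f)(x)\,f(x)\,dx .$$ Let $\mathring H^s(\mathbb R^d)$ be the Hilbert space of real functions $u\in L^{\frac{2d}{d-2s}}(\mathbb R^d)$ whose (distributional) Fourier transform $\hat u$ is a locally integrable function and satisfies $\|u\|_{\mathring H^s}^2=\int_{\mathbb R^d}|\xi|^{2s}|\hat u(\xi)|^2\,d\xi<\infty$, where the Fourier transform is normalized by $\hat u(\xi)=(2\pi)^{-d/2}\int_{\mathbb R^d} e^{-ix\cdot\xi}u(x)\,dx$, with inner product $\langle u,v\rangle_{\mathring H^s}=\int_{\mathbb R^d}|\xi|^{2s}\hat u(\xi)\overline{\hat v(\xi)}\,d\xi$, and let $\mathring H^{-s}(\mathbb R^d)$ be its dual space with the dual norm. Let $T\in L^1_{loc}(\mathbb R^d)$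 be real-valued with $\mathcal D_{2s}(|T|,|T|)<\infty$. Then the integral $(I_{2s}*T)(x)$ converges absolutely for almost every $x$, the function $(I_{2s}*T)\,T$ is integrable, and the following hold. 1. $T$ generates a bounded linear functional on $\mathring H^s(\mathbb R^d)$: $C_c^\infty(\mathbb R^d)\subset\mathring H^s(\mathbb R^d)$, and the functional $\varphi\mapsto\int_{\mathbb R^d}T\varphi\,dx$ on $C_c^\infty(\mathbb R^d)$ has a unique continuous linear extension to $\mathring H^s(\mathbb R^d)$, again denoted by $T\in\mathring H^{-s}(\mathbb R^d)$. 2. There is a unique $U_T\in\mathring H^s(\mathbb R^d)$ with $\langle T,v\rangle=\langle U_T,v\rangle_{\mathring H^s}$ for all $v\in\mathring H^s(\mathbb R^d)$, and $U_T=I_{2s}*T$ almost everywhere. 3. $\|T\|_{\mathring H^{-s}}^2=\mathcal D_{2s}(T,T)$. -/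

import Mathlib

open MeasureTheory Set Filter
open scoped ENNReal ContDiff SchwartzMap FourierTransform ComplexConjugate

noncomputable section

/-! ### Riesz potentials and the Coulomb type energy on `ℝᵈ` -/

/-- The Riesz kernel `I_α(x) = A_α |x|^(α - d)` with
`A_α = Γ((d - α)/2) / (π^(d/2) 2^α Γ(α/2))`. -/
def rieszKernel (d : ℕ) (α : ℝ) (x : EuclideanSpace ℝ (Fin d)) : ℝ :=
  Real.Gamma ((d - α) / 2) / (Real.pi ^ ((d : ℝ) / 2) * 2 ^ α * Real.Gamma (α / 2))
    * ‖x‖ ^ (α - d)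

/-- The Riesz potential `(I_α * f)(x) = ∫ I_α(x - y) f(y) dy`. -/
def rieszPotential {d : ℕ} (α : ℝ) (f : EuclideanSpace ℝ (Fin d) → ℝ)
    (x : EuclideanSpace ℝ (Fin d)) : ℝ :=
  ∫ y, rieszKernel d α (x - y) * f y

/-- The energy `𝓓_α(f, f) = ∫ (I_α * f)(x) f(x) dx`. -/
def rieszEnergy {d : ℕ} (α : ℝ) (f : EuclideanSpace ℝ (Fin d) → ℝ) : ℝ :=
  ∫ x, rieszPotential α f x * f x

/-- The energy `𝓓_α(|f|, |f|) = ∫ (I_α * |f|)(x) |f(x)| dx`, an element of `[0, ∞]`. -/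
def rieszAbsEnergy {d : ℕ} (α : ℝ) (f : EuclideanSpace ℝ (Fin d) → ℝ) : ℝ≥0∞ :=
  ∫⁻ x, (∫⁻ y, ENNReal.ofReal (rieszKernel d α (x - y)) * ENNReal.ofReal |f y|)
    * ENNReal.ofReal |f x|

/-! ### The homogeneous fractional Sobolev space -/

/-- `u` and the locally integrable function `g` are regular tempered distributions, and `g` is the
distributional Fourier transform of `u` (in the normalization `∫ e^(-2πi⟨x, ξ⟩) u(x) dx`),
that is, `⟨g, φ⟩ = ⟨u, 𝓕 φ⟩` for every Schwartz function `φ`. -/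
def IsDistribFourier {d : ℕ} (u : EuclideanSpace ℝ (Fin d) → ℝ)
    (g : EuclideanSpace ℝ (Fin d) → ℂ) : Prop :=
  LocallyIntegrable g ∧
  ∀ φ : 𝓢(EuclideanSpace ℝ (Fin d), ℂ),
    Integrable (fun x => (u x : ℂ) * (𝓕 φ : 𝓢(EuclideanSpace ℝ (Fin d), ℂ)) x) ∧
    Integrable (fun ξ => g ξ * φ ξ) ∧
    ∫ ξ, g ξ * φ ξ = ∫ x, (u x : ℂ) * (𝓕 φ : 𝓢(EuclideanSpace ℝ (Fin d), ℂ)) x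

/-- The real functions `u` with finite `(∫ |ξ|^(2s) |û(ξ)|² dξ)^(1/2)`, where `û` is a function and
`û(ξ) = (2π)^(-d/2) ∫ e^(-i⟨x, ξ⟩) u(x) dx`. In terms of the Fourier transform `g` of Mathlib
one has `û(ξ) = (2π)^(-d/2) g(ξ/(2π))`, so the square of this norm is
`∫ (2π|ξ|)^(2s) |g(ξ)|² dξ`. -/
def HasFiniteHomNorm {d : ℕ} (s : ℝ) (u : EuclideanSpace ℝ (Fin d) → ℝ) : Prop :=
  ∃ g : EuclideanSpace ℝ (Fin d) → ℂ, IsDistribFourier u g ∧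
    Integrable (fun ξ => (2 * Real.pi * ‖ξ‖) ^ (2 * s) * ‖g ξ‖ ^ 2)

section helpers

variable {d : ℕ} {s : ℝ} {u v : EuclideanSpace ℝ (Fin d) → ℝ}
  {g h k : EuclideanSpace ℝ (Fin d) → ℂ}

theorem IsDistribFourier.unique (hg : IsDistribFourier u g) (hh : IsDistribFourier u h) :
    g =ᵐ[volume] h := by
  refine ae_eq_of_integral_contDiff_smul_eq hg.1 hh.1 fun f hf hfc => ?_
  have h1 : HasCompactSupport (fun x => (f x : ℂ)) :=
    hfc.comp_left (g := fun r : ℝ => (r : ℂ)) rfl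
  have h2 : ContDiff ℝ ∞ (fun x => (f x : ℂ)) := Complex.ofRealCLM.contDiff.comp hf
  have e := ((hg.2 (h1.toSchwartzMap h2)).2.2).trans ((hh.2 (h1.toSchwartzMap h2)).2.2).symm
  simpa [mul_comm, Complex.real_smul] using e

theorem IsDistribFourier.congr (huv : u =ᵐ[volume] v) (hg : IsDistribFourier u g) :
    IsDistribFourier v g := by
  refine ⟨hg.1, fun φ => ?_⟩
  obtain ⟨a, b, c⟩ := hg.2 φ
  have e : (fun x => (u x : ℂ) * (𝓕 φ : 𝓢(EuclideanSpace ℝ (Fin d), ℂ)) x) =ᵐ[volume]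
      fun x => (v x : ℂ) * (𝓕 φ : 𝓢(EuclideanSpace ℝ (Fin d), ℂ)) x := by
    filter_upwards [huv] with x hx
    rw [hx]
  exact ⟨a.congr e, b, c.trans (integral_congr_ae e)⟩

theorem IsDistribFourier.add (hg : IsDistribFourier u g) (hh : IsDistribFourier v h) :
    IsDistribFourier (u + v) (g + h) := by
  refine ⟨hg.1.add hh.1, fun φ => ?_⟩
  obtain ⟨a, b, c⟩ := hg.2 φ
  obtain ⟨a', b', c'⟩ := hh.2 φ
  refine ⟨?_, ?_, ?_⟩
  · refine (a.add a').congr (Eventually.of_forall fun x => ?_)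
    simp [add_mul]
  · refine (b.add b').congr (Eventually.of_forall fun x => ?_)
    simp [add_mul]
  · simp only [Pi.add_apply, Complex.ofReal_add, add_mul]
    rw [integral_add b b', integral_add a a', c, c']

theorem IsDistribFourier.smul (r : ℝ) (hg : IsDistribFourier u g) :
    IsDistribFourier (r • u) (r • g) := by
  refine ⟨hg.1.smul r, fun φ => ?_⟩
  obtain ⟨a, b, c⟩ := hg.2 φ
  refine ⟨?_, ?_, ?_⟩
  · simpa [mul_assoc] using a.const_mul (r : ℂ)
  · simpa [mul_assoc, Complex.real_smul] using b.const_mul (r : ℂ)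
  · simp only [Pi.smul_apply, smul_eq_mul, Complex.ofReal_mul, Complex.real_smul, mul_assoc]
    rw [integral_const_mul, integral_const_mul, c]

theorem IsDistribFourier.zero : IsDistribFourier (d := d) 0 0 :=
  ⟨locallyIntegrable_zero, fun φ => by simp⟩

theorem integrable_weight_mul
    (hg : AEStronglyMeasurable g) (hh : AEStronglyMeasurable h)
    (ig : Integrable (fun ξ => (2 * Real.pi * ‖ξ‖) ^ (2 * s) * ‖g ξ‖ ^ 2))
    (ih : Integrable (fun ξ => (2 * Real.pi * ‖ξ‖) ^ (2 * s) * ‖h ξ‖ ^ 2)) :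
    Integrable (fun ξ => (2 * Real.pi * ‖ξ‖) ^ (2 * s) * (g ξ * conj (h ξ)).re) := by
  have hw : Measurable fun ξ : EuclideanSpace ℝ (Fin d) => (2 * Real.pi * ‖ξ‖) ^ (2 * s) := by
    fun_prop
  refine (ig.add ih).mono' ?_ (Eventually.of_forall fun ξ => ?_)
  · exact hw.aestronglyMeasurable.mul (Complex.continuous_re.comp_aestronglyMeasurable
      (hg.mul (Complex.continuous_conj.comp_aestronglyMeasurable hh)))
  · have w0 : (0 : ℝ) ≤ (2 * Real.pi * ‖ξ‖) ^ (2 * s) := by positivity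
    have h1 : |(g ξ * conj (h ξ)).re| ≤ ‖g ξ‖ * ‖h ξ‖ := by
      refine (Complex.abs_re_le_norm _).trans ?_
      simp
    rw [Real.norm_eq_abs, abs_mul, abs_of_nonneg w0, Pi.add_apply, ← mul_add]
    refine mul_le_mul_of_nonneg_left (h1.trans ?_) w0
    nlinarith [sq_nonneg (‖g ξ‖ - ‖h ξ‖), sq_nonneg (‖g ξ‖ + ‖h ξ‖)]

theorem HasFiniteHomNorm.congr (huv : u =ᵐ[volume] v) (hu : HasFiniteHomNorm s u) :
    HasFiniteHomNorm s v := by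
  obtain ⟨g, hg, ig⟩ := hu
  exact ⟨g, hg.congr huv, ig⟩

theorem HasFiniteHomNorm.add (hu : HasFiniteHomNorm s u) (hv : HasFiniteHomNorm s v) :
    HasFiniteHomNorm s (u + v) := by
  obtain ⟨g, hg, ig⟩ := hu
  obtain ⟨h, hh, ih⟩ := hv
  refine ⟨g + h, hg.add hh, ?_⟩
  have i3 := (integrable_weight_mul hg.1.aestronglyMeasurable hh.1.aestronglyMeasurable ig
    ih).const_mul 2
  refine ((ig.add ih).add i3).congr (Eventually.of_forall fun ξ => ?_)
  have e : ‖g ξ + h ξ‖ ^ 2 = ‖g ξ‖ ^ 2 + ‖h ξ‖ ^ 2 + 2 * (g ξ * conj (h ξ)).re := by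
    simp only [← Complex.normSq_eq_norm_sq, Complex.normSq_add]
  simp only [Pi.add_apply, e]
  ring

theorem HasFiniteHomNorm.smul (r : ℝ) (hu : HasFiniteHomNorm s u) :
    HasFiniteHomNorm s (r • u) := by
  obtain ⟨g, hg, ig⟩ := hu
  refine ⟨r • g, hg.smul r, (ig.const_mul (r ^ 2)).congr (Eventually.of_forall fun ξ => ?_)⟩
  simp only [Pi.smul_apply, norm_smul, mul_pow, Real.norm_eq_abs, sq_abs]
  ring

end helpers

/-- `{u ∈ L^p(ℝᵈ) : ‖u‖_{H̊ˢ} < ∞}` with `p = 2d/(d - 2s)`, as a subspace of `L^p(ℝᵈ)`. -/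
def homSobolevSubmodule (d : ℕ) (s : ℝ) :
    Submodule ℝ (Lp (α := EuclideanSpace ℝ (Fin d)) ℝ
      (ENNReal.ofReal (2 * d / (d - 2 * s))) volume) where
  carrier := {u | HasFiniteHomNorm s u}
  add_mem' := fun {u v} hu hv => (HasFiniteHomNorm.add hu hv).congr (Lp.coeFn_add u v).symm
  zero_mem' := HasFiniteHomNorm.congr (Lp.coeFn_zero ℝ _ volume).symm
    ⟨0, IsDistribFourier.zero, by simp⟩
  smul_mem' := fun r u hu => (HasFiniteHomNorm.smul r hu).congr (Lp.coeFn_smul r u).symm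

/-- The homogeneous fractional Sobolev space `H̊ˢ(ℝᵈ)` (for `0 < s < d/2`) of real functions,
with the inner product `∫ |ξ|^(2s) û(ξ) conj(v̂(ξ)) dξ` that is defined below. -/
def HomSobolev (d : ℕ) (s : ℝ) : Type := homSobolevSubmodule d s

namespace HomSobolev

variable {d : ℕ} {s : ℝ}

instance : AddCommGroup (HomSobolev d s) := inferInstanceAs (AddCommGroup (homSobolevSubmodule d s))

instance : Module ℝ (HomSobolev d s) := inferInstanceAs (Module ℝ (homSobolevSubmodule d s))

/-- The element of `L^p(ℝᵈ)` underlying an element of `H̊ˢ(ℝᵈ)`. -/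
def toLp (u : HomSobolev d s) : Lp (α := EuclideanSpace ℝ (Fin d)) ℝ
    (ENNReal.ofReal (2 * d / (d - 2 * s))) volume :=
  Subtype.val (p := fun u => u ∈ homSobolevSubmodule d s) u

/-- The function (defined up to null sets) underlying an element of `H̊ˢ(ℝᵈ)`. -/
instance : CoeFun (HomSobolev d s) (fun _ => EuclideanSpace ℝ (Fin d) → ℝ) :=
  ⟨fun u => u.toLp⟩

theorem hasFiniteHomNorm (u : HomSobolev d s) : HasFiniteHomNorm s u :=
  Subtype.property (p := fun u => u ∈ homSobolevSubmodule d s) u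

/-- The Fourier transform of an element of `H̊ˢ(ℝᵈ)`, a function determined up to null sets. -/
def fourier (u : HomSobolev d s) : EuclideanSpace ℝ (Fin d) → ℂ :=
  u.hasFiniteHomNorm.choose

theorem isDistribFourier_fourier (u : HomSobolev d s) : IsDistribFourier u u.fourier :=
  u.hasFiniteHomNorm.choose_spec.1

theorem integrable_fourier (u : HomSobolev d s) :
    Integrable (fun ξ => (2 * Real.pi * ‖ξ‖) ^ (2 * s) * ‖u.fourier ξ‖ ^ 2) :=
  u.hasFiniteHomNorm.choose_spec.2

theorem fourier_add (u v : HomSobolev d s) :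
    (u + v).fourier =ᵐ[volume] u.fourier + v.fourier :=
  (u + v).isDistribFourier_fourier.unique <|
    (u.isDistribFourier_fourier.add v.isDistribFourier_fourier).congr
      (Lp.coeFn_add u.toLp v.toLp).symm

theorem fourier_smul (r : ℝ) (u : HomSobolev d s) :
    (r • u).fourier =ᵐ[volume] r • u.fourier :=
  (r • u).isDistribFourier_fourier.unique <|
    (u.isDistribFourier_fourier.smul r).congr (Lp.coeFn_smul r u.toLp).symm

/-- `⟨u, v⟩ = ∫ |ξ|^(2s) û(ξ) conj(v̂(ξ)) dξ`, written with the Fourier transform of Mathlib. For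
real functions `u`, `v` this integral is real, since then the real part of the integrand is even
and its imaginary part is odd; so only the real part is integrated. -/
def innerProd (u v : HomSobolev d s) : ℝ :=
  ∫ ξ, (2 * Real.pi * ‖ξ‖) ^ (2 * s) * (u.fourier ξ * conj (v.fourier ξ)).re

theorem integrable_innerProd (u v : HomSobolev d s) :
    Integrable (fun ξ => (2 * Real.pi * ‖ξ‖) ^ (2 * s) * (u.fourier ξ * conj (v.fourier ξ)).re) :=
  integrable_weight_mul u.isDistribFourier_fourier.1.aestronglyMeasurable
    v.isDistribFourier_fourier.1.aestronglyMeasurable u.integrable_fourier v.integrable_fourier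

/-- The inner product makes `H̊ˢ(ℝᵈ)` a (semi-)inner product space. -/
abbrev core (d : ℕ) (s : ℝ) : PreInnerProductSpace.Core ℝ (HomSobolev d s) where
  inner := innerProd
  conj_inner_symm u v := by
    simp only [innerProd, conj_trivial]
    congr 1
    funext ξ
    simp only [Complex.mul_re, Complex.conj_re, Complex.conj_im]
    ring
  re_inner_nonneg u := by
    simp only [innerProd, RCLike.re_to_real]
    refine integral_nonneg fun ξ => mul_nonneg (by positivity) ?_
    rw [Complex.mul_conj]
    exact Complex.normSq_nonneg _
  add_left u v w := by
    simp only [innerProd]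
    rw [← integral_add (u.integrable_innerProd w) (v.integrable_innerProd w)]
    refine integral_congr_ae ?_
    filter_upwards [fourier_add u v] with ξ hξ
    rw [hξ, Pi.add_apply, add_mul, Complex.add_re, mul_add]
  smul_left u v r := by
    simp only [innerProd, conj_trivial]
    rw [← integral_const_mul]
    refine integral_congr_ae ?_
    filter_upwards [fourier_smul r u] with ξ hξ
    rw [hξ, Pi.smul_apply, Complex.real_smul, mul_assoc (r : ℂ), Complex.re_ofReal_mul]
    ring

/-- The norm `‖u‖ = ⟨u, u⟩^(1/2) = (∫ |ξ|^(2s) |û(ξ)|² dξ)^(1/2)`. -/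
instance : SeminormedAddCommGroup (HomSobolev d s) :=
  @InnerProductSpace.Core.toSeminormedAddCommGroup ℝ (HomSobolev d s) _ _ _ (core d s)

instance : InnerProductSpace ℝ (HomSobolev d s) :=
  InnerProductSpace.ofCore (core d s)

theorem inner_def (u v : HomSobolev d s) :
    inner ℝ u v =
      ∫ ξ, (2 * Real.pi * ‖ξ‖) ^ (2 * s) * (u.fourier ξ * conj (v.fourier ξ)).re := rfl

theorem norm_sq_eq (u : HomSobolev d s) :
    ‖u‖ ^ 2 = ∫ ξ, (2 * Real.pi * ‖ξ‖) ^ (2 * s) * ‖u.fourier ξ‖ ^ 2 := by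
  rw [← real_inner_self_eq_norm_sq, inner_def]
  congr 1
  funext ξ
  rw [Complex.mul_conj, Complex.ofReal_re, Complex.normSq_eq_norm_sq]

/-- The element `L` of the dual `H̊⁻ˢ(ℝᵈ)` is an extension of the functional `φ ↦ ∫ T φ` on
`C_c^∞(ℝᵈ)`; in particular the test functions belong to `H̊ˢ(ℝᵈ)`. -/
def Extends (L : StrongDual ℝ (HomSobolev d s)) (T : EuclideanSpace ℝ (Fin d) → ℝ) : Prop :=
  ∀ φ : EuclideanSpace ℝ (Fin d) → ℝ, ContDiff ℝ ∞ φ → HasCompactSupport φ →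
    ∃ u : HomSobolev d s, u =ᵐ[volume] φ ∧ L u = ∫ x, T x * φ x

end HomSobolev

end

/-! Write `w(ξ) = 2π‖ξ‖`. Formally the Fourier transform of `U = I_{2s} * T` is `w^(-2s) T̂`, so
that `⟨U, φ⟩ = ∫ T̂ conj(φ̂) = ∫ T φ` for test functions and `‖U‖² = ∫ w^(-2s) |T̂|² = 𝓓(T, T)`. The
functional is therefore taken to be `⟨U, ·⟩`. Its representative is thus known from the outset, and
neither the Riesz representation theorem nor completeness of the Sobolev space is needed.

The common tool is subordination to the heat kernel, `Γ(s) I_{2s} = ∫₀^∞ t^(s-1) h_t dt`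
(`integral_rpow_mul_heatKernel`). It serves twice.

In real space it gives the membership `U ∈ L^p`, `p = 2d/(d-2s)`. For `f = |T|`, finite energy
bounds `e^(tΔ)f` pointwise by `A t^(-(d/4+s/2))` and makes `G(x) = ∫ t^(s-1) (e^(tΔ)f(x))² dt`
integrable. Interpolating between the two bounds at each point yields `I_{2s} * f ≤ C G^(1/p)`
(`lintegral_lrieszPotential_rpow_lt_top`).

On the Fourier side the quadratic form of `h_t` is diagonal, with multiplier `e^(-t w²)`.
Integration in `t` gives Parseval's identity with weight `w^(-2s)` for integrable functions of
finite energy (`integrable_weight_mul_normSq_fourier`).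

A general `T` is not integrable, so it is truncated to balls. By Parseval the functions `w^(-s) T̂ₙ`
are Cauchy in `L²`. With `h` their limit, `w^(-s) h` is the distributional transform of `U`, and
`‖h‖²` is the energy (`exists_limit_weight_mul_fourier`, `isDistribFourier_rieszPotential`).

Uniqueness of the functional is density of test functions (`HomSobolev.dense_test`). Uniqueness of
the representative is definiteness of the norm (`HomSobolev.eq_zero_of_toL2_eq_zero`). -/

noncomputable section

/-! ### The heat kernel and subordination of the Riesz kernel. -/

/-- The heat kernel on `ℝᵈ`. -/
def heatKernel (d : ℕ) (t : ℝ) (x : EuclideanSpace ℝ (Fin d)) : ℝ :=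
  (4 * Real.pi * t) ^ (-(d : ℝ) / 2) * Real.exp (-‖x‖ ^ 2 / (4 * t))

section heat

variable {d : ℕ} {s : ℝ}

theorem heatKernel_nonneg {t : ℝ} (ht : 0 ≤ t) (x : EuclideanSpace ℝ (Fin d)) :
    0 ≤ heatKernel d t x := by
  unfold heatKernel; positivity

theorem measurable_heatKernel :
    Measurable fun p : ℝ × EuclideanSpace ℝ (Fin d) => heatKernel d p.1 p.2 := by
  unfold heatKernel; fun_prop

theorem heatKernel_neg (t : ℝ) (x : EuclideanSpace ℝ (Fin d)) :
    heatKernel d t (-x) = heatKernel d t x := by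
  simp [heatKernel]

theorem heatKernel_sub_comm (t : ℝ) (x y : EuclideanSpace ℝ (Fin d)) :
    heatKernel d t (x - y) = heatKernel d t (y - x) := by
  rw [← heatKernel_neg, neg_sub]

theorem measurable_rieszKernel (α : ℝ) : Measurable (rieszKernel d α) := by
  unfold rieszKernel; fun_prop

theorem rieszKernel_nonneg (hs : 0 < s) (hsd : s < (d : ℝ) / 2) (x : EuclideanSpace ℝ (Fin d)) :
    0 ≤ rieszKernel d (2 * s) x := by
  unfold rieszKernel
  have h1 : 0 < Real.Gamma ((d - 2 * s) / 2) := Real.Gamma_pos_of_pos (by linarith)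
  have h2 : 0 < Real.Gamma (2 * s / 2) := Real.Gamma_pos_of_pos (by linarith)
  positivity

/-- `∫ t^(a-1) exp(-b/t) dt` after the substitution `t ↦ 1/t`. -/
theorem integral_rpow_mul_exp_neg_div {a b : ℝ} (ha : 0 < a) (hb : 0 < b) :
    IntegrableOn (fun t : ℝ => t ^ (-a - 1) * Real.exp (-(b / t))) (Ioi 0) ∧
    ∫ t in Ioi (0 : ℝ), t ^ (-a - 1) * Real.exp (-(b / t)) = (1 / b) ^ a * Real.Gamma a := by
  -- The left side is the Gamma integrand after the power substitution `y = t^(-1)`, with the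
  -- Jacobian in the form `|p| t^(p-1)` for `p = -1`.
  have e : ∀ t ∈ Ioi (0 : ℝ), (|(-1 : ℝ)| * t ^ ((-1 : ℝ) - 1)) •
      ((t ^ (-1 : ℝ)) ^ (a - 1) * Real.exp (-(b * t ^ (-1 : ℝ)))) =
      t ^ (-a - 1) * Real.exp (-(b / t)) := by
    intro t ht
    have ht' : (0 : ℝ) < t := ht
    rw [Real.rpow_neg_one, abs_neg, abs_one, one_mul, smul_eq_mul, ← mul_assoc,
      ← Real.rpow_neg_one t, ← Real.rpow_mul ht'.le, ← Real.rpow_add ht', Real.rpow_neg_one,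
      div_eq_mul_inv]
    congr 2
    ring
  have i0 : IntegrableOn (fun y : ℝ => y ^ (a - 1) * Real.exp (-(b * y))) (Ioi 0) := by
    have := integrableOn_rpow_mul_exp_neg_mul_rpow (s := a - 1) (p := 1) (b := b)
      (by linarith) one_pos hb
    simpa using this
  constructor
  · refine IntegrableOn.congr_fun ?_ e measurableSet_Ioi
    exact (integrableOn_Ioi_comp_rpow_iff _ (by norm_num : (-1 : ℝ) ≠ 0)).2 i0
  · rw [← Real.integral_rpow_mul_exp_neg_mul_Ioi ha hb,
      ← integral_comp_rpow_Ioi (fun y : ℝ => y ^ (a - 1) * Real.exp (-(b * y)))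
      (by norm_num : (-1 : ℝ) ≠ 0)]
    exact (setIntegral_congr_fun measurableSet_Ioi e).symm

/-- Subordination of the Riesz kernel to the heat kernel. -/
theorem integral_rpow_mul_heatKernel (hs : 0 < s) (hsd : s < (d : ℝ) / 2) {c : ℝ} (hc : 0 < c)
    {x : EuclideanSpace ℝ (Fin d)} (hx : x ≠ 0) :
    IntegrableOn (fun t : ℝ => t ^ (s - 1) * heatKernel d (c * t) x) (Ioi 0) ∧
    ∫ t in Ioi (0 : ℝ), t ^ (s - 1) * heatKernel d (c * t) x =
      c ^ (-s) * Real.Gamma s * rieszKernel d (2 * s) x := by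
  have hr : 0 < ‖x‖ := norm_pos_iff.2 hx
  have ha : 0 < (d : ℝ) / 2 - s := by linarith
  have hb : 0 < ‖x‖ ^ 2 / (4 * c) := by positivity
  obtain ⟨h1, h2⟩ := integral_rpow_mul_exp_neg_div ha hb
  have e : ∀ t ∈ Ioi (0 : ℝ), (4 * Real.pi * c) ^ (-(d : ℝ) / 2) *
      (t ^ (-((d : ℝ) / 2 - s) - 1) * Real.exp (-(‖x‖ ^ 2 / (4 * c) / t))) =
      t ^ (s - 1) * heatKernel d (c * t) x := by
    intro t ht
    have ht' : (0 : ℝ) < t := ht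
    have e1 : t ^ (-((d : ℝ) / 2 - s) - 1) = t ^ (s - 1) * t ^ (-(d : ℝ) / 2) := by
      rw [← Real.rpow_add ht']; congr 1; ring
    have e2 : -(‖x‖ ^ 2 / (4 * c) / t) = -‖x‖ ^ 2 / (4 * (c * t)) := by
      field_simp
    rw [heatKernel, ← mul_assoc (4 * Real.pi) c t, Real.mul_rpow (by positivity) ht'.le, e1, e2]
    ring
  refine ⟨(IntegrableOn.congr_fun (h1.const_mul _) e measurableSet_Ioi), ?_⟩
  rw [← setIntegral_congr_fun measurableSet_Ioi e, integral_const_mul, h2, rieszKernel]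
  have hG : Real.Gamma s ≠ 0 := (Real.Gamma_pos_of_pos hs).ne'
  have e3 : (1 / (‖x‖ ^ 2 / (4 * c))) ^ ((d : ℝ) / 2 - s) =
      4 ^ ((d : ℝ) / 2 - s) * c ^ ((d : ℝ) / 2 - s) * ‖x‖ ^ (2 * s - d) := by
    rw [one_div_div, Real.div_rpow (by positivity) (by positivity),
      Real.mul_rpow (by positivity) hc.le, ← Real.rpow_natCast, ← Real.rpow_mul hr.le,
      div_eq_mul_inv, ← Real.rpow_neg hr.le]
    congr 2
    push_cast; ring
  have e4 : (4 * Real.pi * c) ^ (-(d : ℝ) / 2) =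
      4 ^ (-(d : ℝ) / 2) * (Real.pi ^ ((d : ℝ) / 2))⁻¹ * c ^ (-(d : ℝ) / 2) := by
    rw [Real.mul_rpow (by positivity) hc.le, Real.mul_rpow (by positivity) (by positivity),
      ← Real.rpow_neg (by positivity), neg_div]
  have e5 : (4 : ℝ) ^ (-(d : ℝ) / 2) * 4 ^ ((d : ℝ) / 2 - s) = (2 ^ (2 * s))⁻¹ := by
    rw [← Real.rpow_add (by norm_num), ← Real.rpow_neg (by norm_num),
      show (4 : ℝ) = 2 ^ (2 : ℝ) by norm_num, ← Real.rpow_mul (by norm_num)]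
    congr 1; ring
  have e6 : c ^ (-(d : ℝ) / 2) * c ^ ((d : ℝ) / 2 - s) = c ^ (-s) := by
    rw [← Real.rpow_add hc]; congr 1; ring
  rw [e3, e4, show ((d : ℝ) - 2 * s) / 2 = (d : ℝ) / 2 - s by ring,
    show 2 * s / 2 = s by ring, ← e6]
  field_simp
  rw [show (4 : ℝ) ^ (-((d : ℝ) / 2)) = 4 ^ (-(d : ℝ) / 2) by rw [neg_div],
    show ((d : ℝ) - 2 * s) / 2 = d / 2 - s by ring]
  have h2s : (2 : ℝ) ^ (2 * s) ≠ 0 := by positivity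
  have e5' : (4 : ℝ) ^ (-(d : ℝ) / 2) * 4 ^ ((d : ℝ) / 2 - s) * 2 ^ (2 * s) = 1 := by
    rw [e5, inv_mul_cancel₀ h2s]
  linear_combination e5' * Real.Gamma ((d : ℝ) / 2 - s)

theorem lintegral_rpow_mul_heatKernel (hs : 0 < s) (hsd : s < (d : ℝ) / 2) {c : ℝ} (hc : 0 < c)
    {x : EuclideanSpace ℝ (Fin d)} (hx : x ≠ 0) :
    ∫⁻ t in Ioi (0 : ℝ), ENNReal.ofReal (t ^ (s - 1)) * ENNReal.ofReal (heatKernel d (c * t) x) =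
      ENNReal.ofReal (c ^ (-s) * Real.Gamma s) * ENNReal.ofReal (rieszKernel d (2 * s) x) := by
  obtain ⟨h1, h2⟩ := integral_rpow_mul_heatKernel hs hsd hc hx
  have hG := Real.Gamma_pos_of_pos hs
  rw [← ENNReal.ofReal_mul (by positivity), ← h2, ofReal_integral_eq_lintegral_ofReal h1]
  · refine setLIntegral_congr_fun measurableSet_Ioi fun t ht => ?_
    have ht' : (0 : ℝ) < t := ht
    exact (ENNReal.ofReal_mul (by positivity)).symm
  · refine (ae_restrict_iff' measurableSet_Ioi).2 (Eventually.of_forall fun t ht => ?_)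
    have ht' : (0 : ℝ) < t := ht
    exact mul_nonneg (by positivity) (heatKernel_nonneg (by positivity) _)

theorem integrable_rexp_neg_mul_sq_norm {b : ℝ} (hb : 0 < b) :
    Integrable fun v : EuclideanSpace ℝ (Fin d) => Real.exp (-b * ‖v‖ ^ 2) := by
  have := (GaussianFourier.integrable_cexp_neg_mul_sq_norm_add (V := EuclideanSpace ℝ (Fin d))
    (b := b) (by simpa) 0 0).norm
  refine this.congr (Eventually.of_forall fun v => ?_)
  simp only [Complex.norm_exp]
  congr 1
  simp
  left; norm_cast

/-- Semigroup law at equal times, by completing the square: with `m` the midpoint of `x` and `y`,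
the parallelogram law gives `‖x-z‖² + ‖z-y‖² = ‖x-y‖²/2 + 2‖z-m‖²`, and a Gaussian in `z - m`
remains to be integrated. -/
theorem lintegral_heatKernel_mul_heatKernel {t : ℝ} (ht : 0 < t)
    (x y : EuclideanSpace ℝ (Fin d)) :
    ∫⁻ z, ENNReal.ofReal (heatKernel d t (x - z)) * ENNReal.ofReal (heatKernel d t (z - y)) =
      ENNReal.ofReal (heatKernel d (2 * t) (x - y)) := by
  set m := (1 / 2 : ℝ) • (x + y) with hm
  have e : ∀ z, heatKernel d t (x - z) * heatKernel d t (z - y) =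
      (4 * Real.pi * t) ^ (-(d : ℝ) / 2) * (4 * Real.pi * t) ^ (-(d : ℝ) / 2) *
        Real.exp (-‖x - y‖ ^ 2 / (4 * (2 * t))) * Real.exp (-(1 / (2 * t)) * ‖z - m‖ ^ 2) := by
    intro z
    have p : ‖x - z‖ ^ 2 + ‖z - y‖ ^ 2 = ‖x - y‖ ^ 2 / 2 + 2 * ‖z - m‖ ^ 2 := by
      have h1 := parallelogram_law_with_norm ℝ (x - z) (z - y)
      have h2 : x - z + (z - y) = x - y := by abel
      have h3 : x - z - (z - y) = (-2 : ℝ) • (z - m) := by rw [hm]; module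
      rw [h2, h3, norm_smul] at h1
      norm_num at h1
      nlinarith
    have p2 : Real.exp (-‖x - z‖ ^ 2 / (4 * t)) * Real.exp (-‖z - y‖ ^ 2 / (4 * t)) =
        Real.exp (-‖x - y‖ ^ 2 / (4 * (2 * t))) * Real.exp (-(1 / (2 * t)) * ‖z - m‖ ^ 2) := by
      rw [← Real.exp_add, ← Real.exp_add]
      congr 1
      field_simp
      linarith
    simp only [heatKernel]
    linear_combination (4 * Real.pi * t) ^ (-(d : ℝ) / 2) * (4 * Real.pi * t) ^ (-(d : ℝ) / 2) * p2
  have hb : 0 < 1 / (2 * t) := by positivity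
  simp_rw [← ENNReal.ofReal_mul (heatKernel_nonneg ht.le _), e]
  rw [lintegral_sub_right_eq_self (fun z => ENNReal.ofReal
    ((4 * Real.pi * t) ^ (-(d : ℝ) / 2) * (4 * Real.pi * t) ^ (-(d : ℝ) / 2) *
        Real.exp (-‖x - y‖ ^ 2 / (4 * (2 * t))) * Real.exp (-(1 / (2 * t)) * ‖z‖ ^ 2))) m,
    ← ofReal_integral_eq_lintegral_ofReal ((integrable_rexp_neg_mul_sq_norm hb).const_mul _)
      (Eventually.of_forall fun z => by positivity), integral_const_mul,
    GaussianFourier.integral_rexp_neg_mul_sq_norm hb, heatKernel]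
  congr 1
  have h1 : (Real.pi / (1 / (2 * t))) ^ ((Module.finrank ℝ (EuclideanSpace ℝ (Fin d)) : ℝ) / 2) =
      ((2 * Real.pi * t) ^ (-(d : ℝ) / 2))⁻¹ := by
    rw [← Real.rpow_neg (by positivity), finrank_euclideanSpace_fin]
    congr 1
    · field_simp
    · ring
  have h2 : (4 * Real.pi * t) ^ (-(d : ℝ) / 2) * (4 * Real.pi * t) ^ (-(d : ℝ) / 2) =
      (2 * Real.pi * t) ^ (-(d : ℝ) / 2) * (4 * Real.pi * (2 * t)) ^ (-(d : ℝ) / 2) := by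
    rw [← Real.mul_rpow (by positivity) (by positivity),
      ← Real.mul_rpow (by positivity) (by positivity)]
    congr 1; ring
  rw [h1, h2]
  have h3 : (2 * Real.pi * t) ^ (-(d : ℝ) / 2) ≠ 0 := by positivity
  field_simp

/-- The exponential factor increases with time; only the prefactor decreases, and it does so by
exactly `(t/r)^(-d/2)`. -/
theorem heatKernel_mono {r t : ℝ} (hr : 0 < r) (hrt : r ≤ t) (x : EuclideanSpace ℝ (Fin d)) :
    (t / r) ^ (-(d : ℝ) / 2) * heatKernel d r x ≤ heatKernel d t x := by
  have ht := hr.trans_le hrt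
  rw [heatKernel, heatKernel, ← mul_assoc, ← Real.mul_rpow (by positivity) (by positivity),
    show t / r * (4 * Real.pi * r) = 4 * Real.pi * t by field_simp]
  refine mul_le_mul_of_nonneg_left (Real.exp_le_exp.2 ?_) (by positivity)
  rw [neg_div, neg_div, neg_le_neg_iff]
  gcongr

end heat

end

/-! ### Heat extensions of nonnegative functions of finite energy. -/

noncomputable section

/-- The heat extension of a nonnegative function. -/
def heatExtension {d : ℕ} (f : EuclideanSpace ℝ (Fin d) → ℝ≥0∞) (t : ℝ)
    (x : EuclideanSpace ℝ (Fin d)) : ℝ≥0∞ :=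
  ∫⁻ y, ENNReal.ofReal (heatKernel d t (x - y)) * f y

/-- The Riesz potential of a nonnegative function. -/
def lrieszPotential {d : ℕ} (α : ℝ) (f : EuclideanSpace ℝ (Fin d) → ℝ≥0∞)
    (x : EuclideanSpace ℝ (Fin d)) : ℝ≥0∞ :=
  ∫⁻ y, ENNReal.ofReal (rieszKernel d α (x - y)) * f y

section sobolev

variable {d : ℕ} {s : ℝ} {f : EuclideanSpace ℝ (Fin d) → ℝ≥0∞}

theorem measurable_heatExtension (hf : Measurable f) :
    Measurable fun p : ℝ × EuclideanSpace ℝ (Fin d) => heatExtension f p.1 p.2 := by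
  unfold heatExtension
  refine Measurable.lintegral_prod_right' (f := fun p : (ℝ × EuclideanSpace ℝ (Fin d)) ×
    EuclideanSpace ℝ (Fin d) => ENNReal.ofReal (heatKernel d p.1.1 (p.1.2 - p.2)) * f p.2) ?_
  refine Measurable.mul (ENNReal.measurable_ofReal.comp (measurable_heatKernel.comp
    (by fun_prop : Measurable fun p : (ℝ × EuclideanSpace ℝ (Fin d)) ×
    EuclideanSpace ℝ (Fin d) => (p.1.1, p.1.2 - p.2)))) (hf.comp measurable_snd)

theorem measurable_heatExtension_right (hf : Measurable f) (t : ℝ) :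
    Measurable (heatExtension f t) :=
  (measurable_heatExtension hf).comp measurable_prodMk_left

theorem measurable_heatExtension_left (hf : Measurable f) (x : EuclideanSpace ℝ (Fin d)) :
    Measurable fun t => heatExtension f t x :=
  (measurable_heatExtension hf).comp measurable_prodMk_right

theorem measurable_heat_slice (t : ℝ) :
    Measurable fun z : EuclideanSpace ℝ (Fin d) => ENNReal.ofReal (heatKernel d t z) :=
  ENNReal.measurable_ofReal.comp (measurable_heatKernel.comp measurable_prodMk_left)

theorem measurable_lrieszPotential (α : ℝ) (hf : Measurable f) :
    Measurable (lrieszPotential α f) := by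
  unfold lrieszPotential
  refine Measurable.lintegral_prod_right' (f := fun p : EuclideanSpace ℝ (Fin d) ×
    EuclideanSpace ℝ (Fin d) => ENNReal.ofReal (rieszKernel d α (p.1 - p.2)) * f p.2) ?_
  have := measurable_rieszKernel (d := d) α
  fun_prop

/-- Tonelli and subordination, which is valid off the null set `y = x`. The factor `c` is a
rescaling of time; the value `c = 2` of the energy version below matches the doubled time in
`lintegral_heatExtension_sq`. -/
theorem lintegral_rpow_mul_heatExtension [NeZero d] (hs : 0 < s) (hsd : s < (d : ℝ) / 2) {c : ℝ}
    (hc : 0 < c) (hf : Measurable f) (x : EuclideanSpace ℝ (Fin d)) :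
    ∫⁻ t in Ioi (0 : ℝ), ENNReal.ofReal (t ^ (s - 1)) * heatExtension f (c * t) x =
      ENNReal.ofReal (c ^ (-s) * Real.Gamma s) * lrieszPotential (2 * s) f x := by
  have m1 : Measurable fun p : ℝ × EuclideanSpace ℝ (Fin d) =>
      ENNReal.ofReal (p.1 ^ (s - 1)) * (ENNReal.ofReal (heatKernel d (c * p.1) (x - p.2)) * f p.2) :=
    Measurable.mul (by fun_prop) (Measurable.mul (ENNReal.measurable_ofReal.comp
      (measurable_heatKernel.comp (by fun_prop : Measurable fun p : ℝ ×
    EuclideanSpace ℝ (Fin d) => (c * p.1, x - p.2)))) (hf.comp measurable_snd))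
  have m2 : ∀ t, Measurable fun y : EuclideanSpace ℝ (Fin d) =>
      ENNReal.ofReal (heatKernel d (c * t) (x - y)) * f y := fun t =>
    ((measurable_heat_slice (c * t)).comp (measurable_const.sub measurable_id)).mul hf
  have m3 : Measurable fun y : EuclideanSpace ℝ (Fin d) =>
      ENNReal.ofReal (rieszKernel d (2 * s) (x - y)) * f y := by
    have := measurable_rieszKernel (d := d) (2 * s)
    fun_prop
  unfold heatExtension lrieszPotential
  simp_rw [← lintegral_const_mul _ (m2 _)]
  rw [lintegral_lintegral_swap m1.aemeasurable, ← lintegral_const_mul _ m3]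
  refine lintegral_congr_ae ?_
  have : ∀ᵐ y : EuclideanSpace ℝ (Fin d), y ≠ x := by
    simp [ae_iff]
  filter_upwards [this] with y hy
  rw [← mul_assoc, ← lintegral_rpow_mul_heatKernel hs hsd hc (sub_ne_zero.2 hy.symm),
    ← lintegral_mul_const]
  · simp_rw [mul_assoc]
  · exact Measurable.mul (by fun_prop) (ENNReal.measurable_ofReal.comp
      (measurable_heatKernel.comp (by fun_prop : Measurable fun t : ℝ => (c * t, x - y))))

theorem lintegral_heatKernel_mul_heatExtension (hf : Measurable f) {t : ℝ} (ht : 0 < t)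
    (x : EuclideanSpace ℝ (Fin d)) :
    ∫⁻ z, ENNReal.ofReal (heatKernel d t (x - z)) * heatExtension f t z =
      heatExtension f (2 * t) x := by
  have mh := measurable_heat_slice (d := d) t
  unfold heatExtension
  have m2 : ∀ z, Measurable fun y : EuclideanSpace ℝ (Fin d) =>
      ENNReal.ofReal (heatKernel d t (z - y)) * f y := fun z =>
    (mh.comp (measurable_const.sub measurable_id)).mul hf
  simp_rw [← lintegral_const_mul _ (m2 _)]
  rw [lintegral_lintegral_swap]
  · refine lintegral_congr fun y => ?_
    rw [← lintegral_heatKernel_mul_heatKernel ht, ← lintegral_mul_const]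
    · simp_rw [mul_assoc]
    · exact (mh.comp (measurable_const.sub measurable_id)).mul
        (mh.comp (measurable_id.sub measurable_const))
  · refine Measurable.aemeasurable ?_
    exact Measurable.mul (mh.comp (by fun_prop)) (Measurable.mul (mh.comp
      (by fun_prop : Measurable fun p : EuclideanSpace ℝ (Fin d) × EuclideanSpace ℝ (Fin d) =>
        p.1 - p.2)) (by fun_prop))

/-- The heat operator is symmetric and its square is the operator at time `2t`. -/
theorem lintegral_heatExtension_sq (hf : Measurable f) {t : ℝ} (ht : 0 < t) :
    ∫⁻ x, heatExtension f t x ^ 2 = ∫⁻ x, heatExtension f (2 * t) x * f x := by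
  have mh := measurable_heat_slice (d := d) t
  have mq := measurable_heatExtension_right hf t
  have e : ∀ x, heatExtension f t x ^ 2 = ∫⁻ y,
      ENNReal.ofReal (heatKernel d t (x - y)) * f y * heatExtension f t x := by
    intro x
    rw [lintegral_mul_const, sq, heatExtension]
    exact (mh.comp (measurable_const.sub measurable_id)).mul hf
  simp_rw [e]
  rw [lintegral_lintegral_swap]
  · refine lintegral_congr fun y => ?_
    rw [← lintegral_heatKernel_mul_heatExtension hf ht, ← lintegral_mul_const]
    · refine lintegral_congr fun x => ?_
      rw [heatKernel_sub_comm]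
      ring
    · exact (mh.comp (measurable_const.sub measurable_id)).mul mq
  · refine Measurable.aemeasurable ?_
    exact Measurable.mul (Measurable.mul (mh.comp
      (by fun_prop : Measurable fun p : EuclideanSpace ℝ (Fin d) × EuclideanSpace ℝ (Fin d) =>
        p.1 - p.2)) (by fun_prop)) (by fun_prop)

theorem lintegral_rpow_mul_heat_energy [NeZero d] (hs : 0 < s) (hsd : s < (d : ℝ) / 2) {c : ℝ}
    (hc : 0 < c) (hf : Measurable f) :
    ∫⁻ t in Ioi (0 : ℝ), ENNReal.ofReal (t ^ (s - 1)) * ∫⁻ x, heatExtension f (c * t) x * f x =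
      ENNReal.ofReal (c ^ (-s) * Real.Gamma s) * ∫⁻ x, lrieszPotential (2 * s) f x * f x := by
  have mq := measurable_heatExtension hf
  have m1 := measurable_lrieszPotential (2 * s) hf
  have m2 : ∀ t, Measurable fun x => heatExtension f (c * t) x * f x := fun t =>
    (measurable_heatExtension_right hf _).mul hf
  have m3 : Measurable fun x => lrieszPotential (2 * s) f x * f x := m1.mul hf
  simp_rw [← lintegral_const_mul _ (m2 _)]
  rw [← lintegral_const_mul _ m3, lintegral_lintegral_swap]
  · refine lintegral_congr fun x => ?_
    have m4 : Measurable fun t => heatExtension f (c * t) x :=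
      (measurable_heatExtension_left hf x).comp (measurable_const_mul c)
    have m5 : Measurable fun t : ℝ =>
        ENNReal.ofReal (t ^ (s - 1)) * heatExtension f (c * t) x :=
      Measurable.mul (f := fun t : ℝ => ENNReal.ofReal (t ^ (s - 1))) (by fun_prop) m4
    rw [← mul_assoc, ← lintegral_rpow_mul_heatExtension hs hsd hc hf, ← lintegral_mul_const _ m5]
    simp_rw [mul_assoc]
  · have m4 : Measurable fun p : ℝ × EuclideanSpace ℝ (Fin d) =>
        heatExtension f (c * p.1) p.2 := by
      have h : Measurable fun p : ℝ × EuclideanSpace ℝ (Fin d) => (c * p.1, p.2) :=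
        (measurable_fst.const_mul c).prodMk measurable_snd
      have h' := mq.comp h
      simpa only [Function.comp_def] using h'
    have m5 : Measurable fun p : ℝ × EuclideanSpace ℝ (Fin d) => ENNReal.ofReal (p.1 ^ (s - 1)) := by
      fun_prop
    exact (m5.mul (m4.mul (hf.comp measurable_snd))).aemeasurable

/-- Yields `⟨e^(rΔ)f, f⟩ ≤ C r^(-s)`. In the subordination formula for the energy, only `t > r` is
kept; there `heatKernel_mono` bounds the form at time `t` below by `(t/r)^(-d/2)` times the form at
time `r`, and the remaining integral in `t` is `r^s / (d/2 - s)`. -/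
theorem heat_energy_le [NeZero d] (hs : 0 < s) (hsd : s < (d : ℝ) / 2) (hf : Measurable f)
    {r : ℝ} (hr : 0 < r) :
    ENNReal.ofReal (r ^ s / ((d : ℝ) / 2 - s)) * ∫⁻ x, heatExtension f r x * f x ≤
      ENNReal.ofReal (Real.Gamma s) * ∫⁻ x, lrieszPotential (2 * s) f x * f x := by
  have hG := lintegral_rpow_mul_heat_energy hs hsd one_pos hf
  rw [Real.one_rpow, one_mul] at hG
  simp_rw [one_mul] at hG
  rw [← hG]
  have ha : s - 1 + -(d : ℝ) / 2 < -1 := by linarith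
  have e1 : ∫ t in Ioi r, t ^ (s - 1) * (t / r) ^ (-(d : ℝ) / 2) = r ^ s / ((d : ℝ) / 2 - s) ∧
      IntegrableOn (fun t => t ^ (s - 1) * (t / r) ^ (-(d : ℝ) / 2)) (Ioi r) := by
    have e : ∀ t ∈ Ioi r, r ^ ((d : ℝ) / 2) * t ^ (s - 1 + -(d : ℝ) / 2) =
        t ^ (s - 1) * (t / r) ^ (-(d : ℝ) / 2) := by
      intro t ht
      have ht' : 0 < t := hr.trans ht
      rw [Real.rpow_add ht', Real.div_rpow ht'.le hr.le, neg_div, Real.rpow_neg hr.le]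
      field_simp
    refine ⟨?_, IntegrableOn.congr_fun
      ((integrableOn_Ioi_rpow_of_lt ha hr).const_mul _) e measurableSet_Ioi⟩
    rw [← setIntegral_congr_fun measurableSet_Ioi e, integral_const_mul,
      integral_Ioi_rpow_of_lt ha hr, mul_div_assoc', mul_neg, ← Real.rpow_add hr,
      show (d : ℝ) / 2 + (s - 1 + -(d : ℝ) / 2 + 1) = s by ring,
      show s - 1 + -(d : ℝ) / 2 + 1 = -((d : ℝ) / 2 - s) by ring, neg_div_neg_eq]
  rw [← e1.1, ofReal_integral_eq_lintegral_ofReal e1.2 ((ae_restrict_iff' measurableSet_Ioi).2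
    (Eventually.of_forall fun t ht => by have : 0 < t := hr.trans ht; positivity)),
    ← lintegral_mul_const _ (by fun_prop)]
  refine le_trans (setLIntegral_mono' measurableSet_Ioi fun t ht => ?_)
    (lintegral_mono_set (Ioi_subset_Ioi hr.le))
  have ht' : 0 < t := hr.trans ht
  have m1 : Measurable fun x => heatExtension f r x * f x :=
    (measurable_heatExtension_right hf _).mul hf
  have m2 : ∀ x, Measurable fun y => ENNReal.ofReal (heatKernel d r (x - y)) * f y := fun x =>
    ((measurable_heat_slice r).comp (measurable_const.sub measurable_id)).mul hf
  rw [ENNReal.ofReal_mul (by positivity), mul_assoc, ← lintegral_const_mul _ m1]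
  refine mul_le_mul_right (lintegral_mono fun x => ?_) _
  rw [← mul_assoc]
  refine mul_le_mul_left ?_ _
  unfold heatExtension
  rw [← lintegral_const_mul _ (m2 x)]
  refine lintegral_mono fun y => ?_
  rw [← mul_assoc, ← ENNReal.ofReal_mul (by positivity)]
  refine mul_le_mul_left (ENNReal.ofReal_le_ofReal (heatKernel_mono hr (le_of_lt ht) _)) _

/-- Cauchy–Schwarz applied to `e^(2tΔ)f(x) = ∫ h_t(x - z) e^(tΔ)f(z) dz`; both `L²` norms are then
evaluated by the semigroup law. -/
theorem heatExtension_sq_le (hf : Measurable f) {t : ℝ} (ht : 0 < t)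
    (x : EuclideanSpace ℝ (Fin d)) :
    heatExtension f (2 * t) x ^ 2 ≤
      ENNReal.ofReal (heatKernel d (2 * t) 0) * ∫⁻ x, heatExtension f (2 * t) x * f x := by
  rw [← lintegral_heatKernel_mul_heatExtension hf ht, ← lintegral_heatExtension_sq hf ht]
  have h := ENNReal.lintegral_mul_le_Lp_mul_Lq (volume : Measure (EuclideanSpace ℝ (Fin d)))
    Real.HolderConjugate.two_two
    (f := fun z => ENNReal.ofReal (heatKernel d t (x - z))) (g := heatExtension f t)
    ((measurable_heat_slice t).comp (measurable_const.sub measurable_id)).aemeasurable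
    (measurable_heatExtension_right hf t).aemeasurable
  have h0 : ∫⁻ z, ENNReal.ofReal (heatKernel d t (x - z)) ^ (2 : ℝ) =
      ENNReal.ofReal (heatKernel d (2 * t) 0) := by
    rw [← sub_self x, ← lintegral_heatKernel_mul_heatKernel ht]
    refine lintegral_congr fun z => ?_
    rw [heatKernel_sub_comm t z x, ENNReal.rpow_ofNat, sq]
  rw [h0] at h
  refine (pow_le_pow_left₀ zero_le h 2).trans_eq ?_
  rw [mul_pow, ← ENNReal.rpow_natCast, ← ENNReal.rpow_mul, ← ENNReal.rpow_natCast,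
    ← ENNReal.rpow_mul]
  simp

/-- `t ↦ t^(d/4 + s/2) (e^(tΔ) f)(x)` is bounded for `f` of finite energy. -/
theorem exists_heatExtension_le [NeZero d] (hs : 0 < s) (hsd : s < (d : ℝ) / 2)
    (hf : Measurable f) (hE : ∫⁻ x, lrieszPotential (2 * s) f x * f x ≠ ⊤) :
    ∃ A : ℝ, 0 ≤ A ∧ ∀ t, 0 < t → ∀ x,
      heatExtension f t x ≤ ENNReal.ofReal (A * t ^ (-((d : ℝ) / 4 + s / 2))) := by
  set E := ∫⁻ x, lrieszPotential (2 * s) f x * f x with hEdef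
  have hk : 0 < (d : ℝ) / 2 - s := by linarith
  have hG := Real.Gamma_pos_of_pos hs
  -- `B` collects the constants of `h_t(0) = (4πt)^(-d/2)` and of the bound `C t^(-s)` for the form.
  -- The square root of `t^(-d/2) t^(-s)` is the claimed power.
  set B : ℝ := (4 * Real.pi) ^ (-(d : ℝ) / 2) *
    (Real.Gamma s * E.toReal * ((d : ℝ) / 2 - s)) with hB
  have hB0 : 0 ≤ B := by positivity
  refine ⟨Real.sqrt B, Real.sqrt_nonneg _, fun t ht x => ?_⟩
  have h1 := heatExtension_sq_le hf (half_pos ht) x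
  rw [show 2 * (t / 2) = t by ring] at h1
  have h2 := heat_energy_le hs hsd hf ht
  have h3 : ∫⁻ x, heatExtension f t x * f x ≤
      ENNReal.ofReal (Real.Gamma s * E.toReal * ((d : ℝ) / 2 - s) * t ^ (-s)) := by
    have hp : 0 < t ^ s / ((d : ℝ) / 2 - s) := by positivity
    rw [← hEdef, ← ENNReal.ofReal_toReal hE, ← ENNReal.ofReal_mul hG.le, mul_comm] at h2
    rw [← ENNReal.le_div_iff_mul_le (by left; simpa using hp) (by left; simp),
      ← ENNReal.ofReal_div_of_pos hp] at h2
    refine h2.trans_eq ?_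
    rw [Real.rpow_neg ht.le]
    congr 1
    field_simp
  have h4 : heatExtension f t x ^ 2 ≤
      ENNReal.ofReal (Real.sqrt B * t ^ (-((d : ℝ) / 4 + s / 2))) ^ 2 := by
    refine h1.trans ((mul_le_mul_right h3 _).trans_eq ?_)
    rw [← ENNReal.ofReal_mul (heatKernel_nonneg ht.le _), ← ENNReal.ofReal_pow (by positivity),
      mul_pow, Real.sq_sqrt hB0]
    congr 1
    rw [heatKernel, Real.mul_rpow (by positivity) ht.le, hB,
      ← Real.rpow_natCast (t ^ (-((d : ℝ) / 4 + s / 2))), ← Real.rpow_mul ht.le, show -((d : ℝ) / 4 + s / 2) * (2 : ℕ) = -(d : ℝ) / 2 + -s by push_cast; ring,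
      Real.rpow_add ht]
    simp
    ring
  exact (ENNReal.pow_le_pow_left_iff two_ne_zero).1 h4

end sobolev
end

/-! ### The Hardy–Littlewood–Sobolev bound. -/

noncomputable section
section sobolev

variable {d : ℕ} {s : ℝ} {f : EuclideanSpace ℝ (Fin d) → ℝ≥0∞}

/-- A one-dimensional interpolation inequality: `∫ t^(s-1) q` is controlled by
`∫ t^(s-1) q²` and by the decay rate of `q`. -/
theorem lintegral_rpow_mul_le_of_decay {q : ℝ → ℝ≥0∞} (hq : Measurable q) {A a M τ : ℝ}
    (hs : 0 < s) (ha : s < a) (hA : 0 ≤ A) (hM : 0 < M) (hτ : 0 < τ)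
    (hqA : ∀ t, 0 < t → q t ≤ ENNReal.ofReal (A * t ^ (-a))) :
    ∫⁻ t in Ioi (0 : ℝ), ENNReal.ofReal (t ^ (s - 1)) * q t ≤
      ENNReal.ofReal (M * (τ ^ s / s)) +
      ENNReal.ofReal M⁻¹ * (∫⁻ t in Ioi (0 : ℝ), ENNReal.ofReal (t ^ (s - 1)) * q t ^ 2) +
      ENNReal.ofReal (A * (τ ^ (s - a) / (a - s))) := by
  have hM0 : ENNReal.ofReal M ≠ 0 := by simpa using hM
  rw [← Ioc_union_Ioi_eq_Ioi hτ.le]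
  refine (lintegral_union_le _ _ _).trans (add_le_add ?_ ?_)
  -- For small times, either `q ≤ M`, or `q > M` and then `q ≤ q²/M`. For large times the decay rate
  -- suffices, since `s < a`.
  · have e1 : ∀ t, q t ≤ ENNReal.ofReal M + ENNReal.ofReal M⁻¹ * q t ^ 2 := by
      intro t
      rw [ENNReal.ofReal_inv_of_pos hM]
      by_cases h : q t ≤ ENNReal.ofReal M
      · exact h.trans le_self_add
      · push Not at h
        refine le_trans ?_ le_add_self
        calc q t = (ENNReal.ofReal M)⁻¹ * (ENNReal.ofReal M * q t) := by
              rw [← mul_assoc, ENNReal.inv_mul_cancel hM0 ENNReal.ofReal_ne_top, one_mul]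
          _ ≤ (ENNReal.ofReal M)⁻¹ * q t ^ 2 := by
              rw [sq]; gcongr
    have i1 : IntegrableOn (fun t : ℝ => t ^ (s - 1)) (Ioc 0 τ) := by
      rw [← intervalIntegrable_iff_integrableOn_Ioc_of_le hτ.le]
      exact intervalIntegral.intervalIntegrable_rpow' (by linarith)
    have i2 : ∫ t in Ioc 0 τ, t ^ (s - 1) = τ ^ s / s := by
      rw [← intervalIntegral.integral_of_le hτ.le, integral_rpow (by left; linarith)]
      simp [Real.zero_rpow hs.ne']
    calc ∫⁻ t in Ioc 0 τ, ENNReal.ofReal (t ^ (s - 1)) * q t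
        ≤ ∫⁻ t in Ioc 0 τ, (ENNReal.ofReal M * ENNReal.ofReal (t ^ (s - 1)) +
            ENNReal.ofReal M⁻¹ * (ENNReal.ofReal (t ^ (s - 1)) * q t ^ 2)) := by
          refine lintegral_mono fun t => ?_
          refine (mul_le_mul_right (e1 t) _).trans_eq ?_
          ring
      _ = ENNReal.ofReal M * (∫⁻ t in Ioc 0 τ, ENNReal.ofReal (t ^ (s - 1))) +
            ENNReal.ofReal M⁻¹ * ∫⁻ t in Ioc 0 τ, ENNReal.ofReal (t ^ (s - 1)) * q t ^ 2 := by
          rw [lintegral_add_left (by fun_prop), lintegral_const_mul _ (by fun_prop),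
            lintegral_const_mul _ (by fun_prop)]
      _ ≤ _ := by
          rw [← ofReal_integral_eq_lintegral_ofReal i1
            ((ae_restrict_iff' measurableSet_Ioc).2 (Eventually.of_forall fun t ht => by
              have : 0 < t := ht.1
              positivity)), i2, ENNReal.ofReal_mul hM.le, Ioc_union_Ioi_eq_Ioi hτ.le]
          gcongr
          exact Ioc_subset_Ioi_self
  · have hlt : s - 1 + -a < -1 := by linarith
    have i1 := integrableOn_Ioi_rpow_of_lt hlt hτ
    have i2 : ∫ t in Ioi τ, A * t ^ (s - 1 + -a) = A * (τ ^ (s - a) / (a - s)) := by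
      rw [integral_const_mul, integral_Ioi_rpow_of_lt hlt hτ,
        show s - 1 + -a + 1 = s - a by ring, ← neg_sub a s, neg_div_neg_eq]
    rw [← i2, ofReal_integral_eq_lintegral_ofReal (i1.const_mul A)
      ((ae_restrict_iff' measurableSet_Ioi).2 (Eventually.of_forall fun t ht => by
              have : 0 < t := hτ.trans ht
              positivity))]
    refine setLIntegral_mono' measurableSet_Ioi fun t ht => ?_
    have ht' : 0 < t := hτ.trans ht
    refine (mul_le_mul_right (hqA t ht') _).trans_eq ?_
    rw [← ENNReal.ofReal_mul (by positivity), Real.rpow_add ht']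
    congr 1; ring

/-- The Hardy-Littlewood-Sobolev inequality in the form: Riesz potentials of finite energy
belong to `L^(2d/(d-2s))`. -/
theorem lintegral_lrieszPotential_rpow_lt_top [NeZero d] (hs : 0 < s) (hsd : s < (d : ℝ) / 2)
    (hf : Measurable f) (hE : ∫⁻ x, lrieszPotential (2 * s) f x * f x ≠ ⊤) :
    ∫⁻ x, lrieszPotential (2 * s) f x ^ (2 * d / (d - 2 * s)) < ⊤ := by
  obtain ⟨A, hA, hqA⟩ := exists_heatExtension_le hs hsd hf hE
  have hd : 0 < (d : ℝ) := by linarith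
  have hk : 0 < (d : ℝ) - 2 * s := by linarith
  have hG := Real.Gamma_pos_of_pos hs
  set p : ℝ := 2 * d / (d - 2 * s) with hp
  have hp0 : 0 < p := by positivity
  have hpi : 1 / p = (d - 2 * s) / (2 * d) := by rw [hp, one_div_div]
  set a : ℝ := (d : ℝ) / 4 + s / 2 with ha
  have has : s < a := by rw [ha]; linarith
  have mq := measurable_heatExtension hf
  -- A square function of the heat extension. Its integral is `2^(-s) Γ(s)` times the energy.
  set G : EuclideanSpace ℝ (Fin d) → ℝ≥0∞ := fun x =>
    ∫⁻ t in Ioi (0 : ℝ), ENNReal.ofReal (t ^ (s - 1)) * heatExtension f t x ^ 2 with hGdef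
  have mG : Measurable G := by
    refine Measurable.lintegral_prod_left' (f := fun p : ℝ × EuclideanSpace ℝ (Fin d) =>
      ENNReal.ofReal (p.1 ^ (s - 1)) * heatExtension f p.1 p.2 ^ 2) ?_
    fun_prop
  have hGint : ∫⁻ x, G x < ⊤ := by
    simp only [hGdef]
    rw [lintegral_lintegral_swap (by
      refine Measurable.aemeasurable ?_
      have := mq.comp measurable_swap
      unfold Function.uncurry
      simp only [Function.comp_def, Prod.swap] at this
      fun_prop)]
    have e : ∫⁻ t in Ioi (0 : ℝ), ∫⁻ x, ENNReal.ofReal (t ^ (s - 1)) * heatExtension f t x ^ 2 =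
        ∫⁻ t in Ioi (0 : ℝ), ENNReal.ofReal (t ^ (s - 1)) *
          ∫⁻ x, heatExtension f (2 * t) x * f x := by
      refine setLIntegral_congr_fun measurableSet_Ioi fun t ht => ?_
      rw [lintegral_const_mul _ ((measurable_heatExtension_right hf t).pow_const 2),
        lintegral_heatExtension_sq hf ht]
    rw [e, lintegral_rpow_mul_heat_energy hs hsd two_pos hf]
    exact ENNReal.mul_lt_top ENNReal.ofReal_lt_top hE.lt_top
  set C : ℝ := 1 / s + 1 + A * (1 / (a - s)) with hC
  have hC0 : 0 ≤ C := by
    have : 0 < a - s := by linarith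
    positivity
  have key : ∀ x, ENNReal.ofReal (Real.Gamma s) * lrieszPotential (2 * s) f x ≤
      ENNReal.ofReal C * G x ^ (1 / p) := by
    intro x
    have h0 := lintegral_rpow_mul_heatExtension hs hsd one_pos hf x
    simp only [one_mul, Real.one_rpow] at h0
    rw [← h0]
    have mqx := measurable_heatExtension_left hf x
    -- The extreme cases are separate because `M` and `τ` below are powers of `G x`. If it vanishes,
    -- so does the extension for almost all times; if it is infinite, the right side is infinite as
    -- `C > 0`.
    rcases eq_or_ne (G x) 0 with hx0 | hx0
    · have : (fun t => ENNReal.ofReal (t ^ (s - 1)) * heatExtension f t x ^ 2)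
          =ᵐ[volume.restrict (Ioi 0)] 0 :=
        (lintegral_eq_zero_iff (by fun_prop)).1 hx0
      have h1 : ∫⁻ t in Ioi (0 : ℝ), ENNReal.ofReal (t ^ (s - 1)) * heatExtension f t x = 0 := by
        rw [lintegral_eq_zero_iff (by fun_prop)]
        filter_upwards [this] with t ht
        simpa using ht
      rw [h1]
      exact zero_le
    rcases eq_or_ne (G x) ⊤ with hxt | hxt
    · rw [hxt, ENNReal.top_rpow_of_pos (by positivity), ENNReal.mul_top]
      · exact le_top
      · have h1 : 0 < 1 / s := by positivity
        have h2 : 0 < a - s := by linarith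
        have : 0 < C := by positivity
        simpa using this
    set g := (G x).toReal with hg
    have hg0 : 0 < g := ENNReal.toReal_pos hx0 hxt
    have hGx : G x = ENNReal.ofReal g := (ENNReal.ofReal_toReal hxt).symm
    -- These choices balance the estimate: since `1/p = 1/2 - s/d`, each of `M τ^s`, `M⁻¹ g` and
    -- `τ^(s-a)` equals `g^(1/p)`.
    refine (lintegral_rpow_mul_le_of_decay (M := g ^ (1 - 1 / p)) (τ := g ^ (-2 / (d : ℝ)))
      mqx hs has hA (by positivity) (by positivity) (fun t ht => hqA t ht x)).trans_eq ?_
    change _ + ENNReal.ofReal _ * G x + _ = _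
    rw [hGx, ENNReal.ofReal_rpow_of_pos hg0, ← ENNReal.ofReal_mul (by positivity),
      ← ENNReal.ofReal_mul hC0, ← ENNReal.ofReal_add (by positivity) (by positivity),
      ← ENNReal.ofReal_add (by positivity)
        (mul_nonneg hA (div_nonneg (by positivity) (by linarith)))]
    congr 1
    have e1 : g ^ (1 - 1 / p) * (g ^ (-2 / (d : ℝ))) ^ s = g ^ (1 / p) := by
      rw [← Real.rpow_mul hg0.le, ← Real.rpow_add hg0, hpi]
      congr 1
      field_simp
      ring
    have e2 : (g ^ (1 - 1 / p))⁻¹ * g = g ^ (1 / p) := by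
      rw [← Real.rpow_neg hg0.le]
      nth_rewrite 2 [← Real.rpow_one g]
      rw [← Real.rpow_add hg0]
      congr 1; ring
    have e3 : (g ^ (-2 / (d : ℝ))) ^ (s - a) = g ^ (1 / p) := by
      rw [← Real.rpow_mul hg0.le, hpi, ha]
      congr 1
      field_simp
      ring
    rw [e2, e3, hC]
    linear_combination (1 / s) * e1
  have key2 : ∀ x, lrieszPotential (2 * s) f x ^ p ≤
      (ENNReal.ofReal (Real.Gamma s)⁻¹ * ENNReal.ofReal C) ^ p * G x := by
    intro x
    have h1 : lrieszPotential (2 * s) f x ≤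
        ENNReal.ofReal (Real.Gamma s)⁻¹ * ENNReal.ofReal C * G x ^ (1 / p) := by
      calc lrieszPotential (2 * s) f x
          = ENNReal.ofReal (Real.Gamma s)⁻¹ *
            (ENNReal.ofReal (Real.Gamma s) * lrieszPotential (2 * s) f x) := by
            rw [← mul_assoc, ← ENNReal.ofReal_mul (by positivity), inv_mul_cancel₀ hG.ne',
              ENNReal.ofReal_one, one_mul]
        _ ≤ _ := by
            rw [mul_assoc]
            exact mul_le_mul_right (key x) _
    refine (ENNReal.rpow_le_rpow h1 hp0.le).trans_eq ?_
    rw [ENNReal.mul_rpow_of_nonneg _ _ hp0.le, ← ENNReal.rpow_mul, one_div_mul_cancel hp0.ne',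
      ENNReal.rpow_one]
  refine (lintegral_mono key2).trans_lt ?_
  rw [lintegral_const_mul _ mG]
  exact ENNReal.mul_lt_top (ENNReal.rpow_lt_top_of_nonneg hp0.le
    (ENNReal.mul_lt_top ENNReal.ofReal_lt_top ENNReal.ofReal_lt_top).ne) hGint

end sobolev
end

/-! ### Parseval's identity for the Riesz energy. -/

noncomputable section
section fourier

variable {d : ℕ} {s : ℝ}

theorem ae_fst_ne_snd [NeZero d] :
    ∀ᵐ p : EuclideanSpace ℝ (Fin d) × EuclideanSpace ℝ (Fin d), p.1 ≠ p.2 := by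
  have hm : MeasurableSet {p : EuclideanSpace ℝ (Fin d) × EuclideanSpace ℝ (Fin d) | p.1 ≠ p.2} :=
    (measurableSet_eq_fun measurable_fst measurable_snd).compl
  refine (Measure.ae_prod_iff_ae_ae hm).2 (Eventually.of_forall fun x => ?_)
  have : ∀ᵐ y : EuclideanSpace ℝ (Fin d), y ≠ x := by simp [ae_iff]
  filter_upwards [this] with y hy using hy.symm

theorem ae_ne_zero [NeZero d] : ∀ᵐ ξ : EuclideanSpace ℝ (Fin d), ξ ≠ 0 := by
  simp [ae_iff]

/-- The heat kernel as a Fourier transform. -/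
theorem heatKernel_eq_integral {t : ℝ} (ht : 0 < t) (z : EuclideanSpace ℝ (Fin d)) :
    (heatKernel d t z : ℂ) = ∫ ξ : EuclideanSpace ℝ (Fin d),
      Complex.exp (↑(-2 * Real.pi * inner ℝ ξ z) * Complex.I) *
        (Real.exp (-(4 * Real.pi ^ 2 * t) * ‖ξ‖ ^ 2) : ℂ) := by
  have hb : 0 < ((4 * Real.pi ^ 2 * t : ℝ) : ℂ).re := by
    rw [Complex.ofReal_re]; positivity
  have h := fourier_gaussian_innerProductSpace hb z
  rw [Real.fourier_eq'] at h
  simp only [smul_eq_mul] at h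
  have e : ∀ ξ : EuclideanSpace ℝ (Fin d), (Real.exp (-(4 * Real.pi ^ 2 * t) * ‖ξ‖ ^ 2) : ℂ) =
      Complex.exp (-((4 * Real.pi ^ 2 * t : ℝ) : ℂ) * (‖ξ‖ : ℂ) ^ 2) := by
    intro ξ; push_cast; rfl
  simp_rw [e]
  rw [h, heatKernel, finrank_euclideanSpace_fin]
  have hp : (0 : ℝ) ≤ Real.pi / (4 * Real.pi ^ 2 * t) := by positivity
  have e1 : ((Real.pi : ℂ) / ((4 * Real.pi ^ 2 * t : ℝ) : ℂ)) ^ ((d : ℂ) / 2) =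
      (((4 * Real.pi * t) ^ (-(d : ℝ) / 2) : ℝ) : ℂ) := by
    rw [← Complex.ofReal_div, show (d : ℂ) / 2 = ((d / 2 : ℝ) : ℂ) by push_cast; rfl,
      ← Complex.ofReal_cpow hp, neg_div, Real.rpow_neg (by positivity),
      ← Real.inv_rpow (by positivity)]
    congr 2
    field_simp
  rw [e1, Complex.ofReal_mul, Complex.ofReal_exp]
  congr 2
  push_cast
  have : (t : ℂ) ≠ 0 := by exact_mod_cast ht.ne'
  have : (Real.pi : ℂ) ≠ 0 := by exact_mod_cast Real.pi_ne_zero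
  field_simp

variable {f k : EuclideanSpace ℝ (Fin d) → ℂ}

theorem continuous_fourier_of_integrable (hf : Integrable f) : Continuous (𝓕 f) :=
  VectorFourier.fourierIntegral_continuous Real.continuous_fourierChar
    (by exact continuous_inner) hf

theorem norm_fourier_le (f : EuclideanSpace ℝ (Fin d) → ℂ) (ξ : EuclideanSpace ℝ (Fin d)) :
    ‖𝓕 f ξ‖ ≤ ∫ x, ‖f x‖ :=
  VectorFourier.norm_fourierIntegral_le_integral_norm _ _ _ _ _

/-- The quadratic form of the heat kernel on the Fourier side. -/
theorem integral_heatKernel_mul_mul (hf : Integrable f) (hk : Integrable k) {t : ℝ} (ht : 0 < t) :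
    ∫ p : EuclideanSpace ℝ (Fin d) × EuclideanSpace ℝ (Fin d),
      (heatKernel d t (p.1 - p.2) : ℂ) * (f p.1 * k p.2) =
    ∫ ξ, (Real.exp (-(4 * Real.pi ^ 2 * t) * ‖ξ‖ ^ 2) : ℂ) * (𝓕 f ξ * 𝓕 k (-ξ)) := by
  have hb : 0 < 4 * Real.pi ^ 2 * t := by positivity
  have ig := (integrable_rexp_neg_mul_sq_norm (d := d) hb).ofReal (𝕜 := ℂ)
  have i1 := (hf.mul_prod hk).mul_prod ig
  have i2 : Integrable (Function.uncurry fun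
      (p : EuclideanSpace ℝ (Fin d) × EuclideanSpace ℝ (Fin d)) (ξ : EuclideanSpace ℝ (Fin d)) =>
      Complex.exp (↑(-2 * Real.pi * inner ℝ ξ (p.1 - p.2)) * Complex.I) *
        ((f p.1 * k p.2) * (Real.exp (-(4 * Real.pi ^ 2 * t) * ‖ξ‖ ^ 2) : ℂ)))
      ((volume.prod volume).prod volume) := by
    refine i1.bdd_mul (c := 1) ?_ (Eventually.of_forall fun p => ?_)
    · exact Continuous.aestronglyMeasurable (by fun_prop)
    · rw [Complex.norm_exp_ofReal_mul_I]
  have e1 : ∀ p : EuclideanSpace ℝ (Fin d) × EuclideanSpace ℝ (Fin d),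
      (heatKernel d t (p.1 - p.2) : ℂ) * (f p.1 * k p.2) = ∫ ξ : EuclideanSpace ℝ (Fin d),
      Complex.exp (↑(-2 * Real.pi * inner ℝ ξ (p.1 - p.2)) * Complex.I) *
        ((f p.1 * k p.2) * (Real.exp (-(4 * Real.pi ^ 2 * t) * ‖ξ‖ ^ 2) : ℂ)) := by
    intro p
    rw [heatKernel_eq_integral ht, ← integral_mul_const]
    congr 1
    ext ξ
    ring
  simp_rw [e1]
  rw [Measure.volume_eq_prod, integral_integral_swap i2]
  congr 1
  ext ξ
  rw [Real.fourier_eq', Real.fourier_eq', ← integral_prod_mul, ← integral_const_mul]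
  congr 1
  ext p
  simp only [smul_eq_mul]
  -- The form is bilinear, without conjugation, so the phase splits into a transform at `ξ` and one
  -- at `-ξ`.
  have : Complex.exp (↑(-2 * Real.pi * inner ℝ ξ (p.1 - p.2)) * Complex.I) =
      Complex.exp (↑(-2 * Real.pi * inner ℝ p.1 ξ) * Complex.I) *
      Complex.exp (↑(-2 * Real.pi * inner ℝ p.2 (-ξ)) * Complex.I) := by
    rw [← Complex.exp_add]
    congr 1
    rw [inner_sub_right, inner_neg_right, real_inner_comm p.1, real_inner_comm p.2]
    push_cast
    ring
  rw [this]
  ring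

/-- The Gamma integral with rate `(2π‖ξ‖)²`: subordination on the level of multipliers. -/
theorem integral_rpow_mul_exp_neg_norm_sq (hs : 0 < s) {ξ : EuclideanSpace ℝ (Fin d)}
    (hξ : ξ ≠ 0) :
    IntegrableOn (fun t : ℝ => t ^ (s - 1) * Real.exp (-(4 * Real.pi ^ 2 * t) * ‖ξ‖ ^ 2)) (Ioi 0) ∧
    ∫ t in Ioi (0 : ℝ), t ^ (s - 1) * Real.exp (-(4 * Real.pi ^ 2 * t) * ‖ξ‖ ^ 2) =
      Real.Gamma s * (2 * Real.pi * ‖ξ‖) ^ (-(2 * s)) := by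
  have hr : 0 < ‖ξ‖ := norm_pos_iff.2 hξ
  have hb : 0 < (2 * Real.pi * ‖ξ‖) ^ 2 := by positivity
  have e : ∀ t : ℝ, -(4 * Real.pi ^ 2 * t) * ‖ξ‖ ^ 2 = -((2 * Real.pi * ‖ξ‖) ^ 2 * t) := by
    intro t; ring
  simp_rw [e]
  constructor
  · simpa using integrableOn_rpow_mul_exp_neg_mul_rpow (s := s - 1) (p := 1)
      (b := (2 * Real.pi * ‖ξ‖) ^ 2) (by linarith) one_pos hb
  · rw [Real.integral_rpow_mul_exp_neg_mul_Ioi hs hb, mul_comm, one_div, Real.inv_rpow hb.le,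
      ← Real.rpow_natCast, ← Real.rpow_mul (by positivity), Real.rpow_neg (by positivity)]
    push_cast
    rfl

/-- Subordination of the Riesz energy to the heat kernel, on the Fourier side. -/
theorem integral_rpow_mul_heat_fourier [NeZero d] (hs : 0 < s) (hsd : s < (d : ℝ) / 2)
    (hf : Integrable f) (hk : Integrable k)
    (hI : Integrable fun p : EuclideanSpace ℝ (Fin d) × EuclideanSpace ℝ (Fin d) =>
      (rieszKernel d (2 * s) (p.1 - p.2) : ℂ) * (f p.1 * k p.2)) :
    IntegrableOn (fun t : ℝ => ((t ^ (s - 1) : ℝ) : ℂ) *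
      ∫ ξ, (Real.exp (-(4 * Real.pi ^ 2 * t) * ‖ξ‖ ^ 2) : ℂ) * (𝓕 f ξ * 𝓕 k (-ξ))) (Ioi 0) ∧
    ∫ t in Ioi (0 : ℝ), ((t ^ (s - 1) : ℝ) : ℂ) *
      ∫ ξ, (Real.exp (-(4 * Real.pi ^ 2 * t) * ‖ξ‖ ^ 2) : ℂ) * (𝓕 f ξ * 𝓕 k (-ξ)) =
    Real.Gamma s * ∫ p : EuclideanSpace ℝ (Fin d) × EuclideanSpace ℝ (Fin d),
      (rieszKernel d (2 * s) (p.1 - p.2) : ℂ) * (f p.1 * k p.2) := by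
  have mh : Measurable fun z : ℝ × EuclideanSpace ℝ (Fin d) × EuclideanSpace ℝ (Fin d) =>
      z.1 ^ (s - 1) * heatKernel d z.1 (z.2.1 - z.2.2) := by
    have h1 : Measurable fun z : ℝ × EuclideanSpace ℝ (Fin d) × EuclideanSpace ℝ (Fin d) =>
        (z.1, z.2.1 - z.2.2) := by fun_prop
    have h2 := measurable_heatKernel.comp h1
    simp only [Function.comp_def] at h2
    fun_prop
  have base : ∀ p : EuclideanSpace ℝ (Fin d) × EuclideanSpace ℝ (Fin d), p.1 ≠ p.2 →
      IntegrableOn (fun t : ℝ => t ^ (s - 1) * heatKernel d t (p.1 - p.2)) (Ioi 0) ∧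
      ∫ t in Ioi (0 : ℝ), t ^ (s - 1) * heatKernel d t (p.1 - p.2) =
        Real.Gamma s * rieszKernel d (2 * s) (p.1 - p.2) := by
    intro p hp
    have := integral_rpow_mul_heatKernel hs hsd one_pos (sub_ne_zero.2 hp)
    simpa using this
  have mfk : AEStronglyMeasurable (fun p : EuclideanSpace ℝ (Fin d) × EuclideanSpace ℝ (Fin d) =>
      f p.1 * k p.2) := (hf.mul_prod hk).aestronglyMeasurable
  set Φ : ℝ → EuclideanSpace ℝ (Fin d) × EuclideanSpace ℝ (Fin d) → ℂ := fun t p =>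
    ((t ^ (s - 1) * heatKernel d t (p.1 - p.2) : ℝ) : ℂ) * (f p.1 * k p.2) with hΦ
  have mΦ : AEStronglyMeasurable (Function.uncurry Φ)
      ((volume.restrict (Ioi (0 : ℝ))).prod volume) := by
    refine AEStronglyMeasurable.mul ?_ mfk.comp_snd
    exact (Complex.measurable_ofReal.comp mh).aestronglyMeasurable
  -- Off the diagonal, integrating the norm in time gives `Γ(s)` times the norm of the Riesz
  -- integrand, so `hI` is what Fubini requires.
  have iΦ : Integrable (Function.uncurry Φ) ((volume.restrict (Ioi (0 : ℝ))).prod volume) := by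
    refine (integrable_prod_iff' mΦ).2 ⟨?_, ?_⟩
    · filter_upwards [ae_fst_ne_snd] with p hp
      exact (Integrable.ofReal (𝕜 := ℂ) (base p hp).1).mul_const (f p.1 * k p.2)
    · refine (hI.norm.const_mul (Real.Gamma s)).congr ?_
      filter_upwards [ae_fst_ne_snd] with p hp
      have : ∀ t ∈ Ioi (0 : ℝ), ‖Function.uncurry Φ (t, p)‖ =
          t ^ (s - 1) * heatKernel d t (p.1 - p.2) * ‖f p.1 * k p.2‖ := by
        intro t ht
        have ht' : (0 : ℝ) < t := ht
        simp only [hΦ, Function.uncurry]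
        rw [norm_mul, Complex.norm_real, Real.norm_of_nonneg]
        exact mul_nonneg (by positivity) (heatKernel_nonneg ht'.le _)
      rw [setIntegral_congr_fun measurableSet_Ioi this, integral_mul_const, (base p hp).2,
        norm_mul, Complex.norm_real, Real.norm_of_nonneg (rieszKernel_nonneg hs hsd _)]
      ring
  have e1 : ∀ t ∈ Ioi (0 : ℝ), ∫ p, Φ t p = ((t ^ (s - 1) : ℝ) : ℂ) *
      ∫ ξ, (Real.exp (-(4 * Real.pi ^ 2 * t) * ‖ξ‖ ^ 2) : ℂ) * (𝓕 f ξ * 𝓕 k (-ξ)) := by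
    intro t ht
    rw [← integral_heatKernel_mul_mul hf hk ht, ← integral_const_mul]
    congr 1
    ext p
    simp only [hΦ]
    push_cast
    ring
  refine ⟨IntegrableOn.congr_fun iΦ.integral_prod_left e1 measurableSet_Ioi, ?_⟩
  rw [← setIntegral_congr_fun measurableSet_Ioi e1, integral_integral_swap iΦ,
    ← integral_const_mul]
  refine integral_congr_ae ?_
  filter_upwards [ae_fst_ne_snd] with p hp
  simp only [hΦ]
  rw [integral_mul_const, integral_complex_ofReal, (base p hp).2]
  push_cast
  ring

/-- Tonelli. One direction justifies exchanging the integrals in Parseval's identity; the other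
extracts integrability of the weighted function from information on the time integrals. -/
theorem integrable_rpow_mul_exp_prod_iff [NeZero d] (hs : 0 < s)
    {F : EuclideanSpace ℝ (Fin d) → ℂ} (hF : AEStronglyMeasurable F) :
    Integrable (fun z : ℝ × EuclideanSpace ℝ (Fin d) =>
      ((z.1 ^ (s - 1) * Real.exp (-(4 * Real.pi ^ 2 * z.1) * ‖z.2‖ ^ 2) : ℝ) : ℂ) * F z.2)
      ((volume.restrict (Ioi (0 : ℝ))).prod volume) ↔
    Integrable fun ξ => (((2 * Real.pi * ‖ξ‖) ^ (-(2 * s)) : ℝ) : ℂ) * F ξ := by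
  have hG := Real.Gamma_pos_of_pos hs
  have m : Measurable fun z : ℝ × EuclideanSpace ℝ (Fin d) =>
      ((z.1 ^ (s - 1) * Real.exp (-(4 * Real.pi ^ 2 * z.1) * ‖z.2‖ ^ 2) : ℝ) : ℂ) := by fun_prop
  have mw : Measurable fun ξ : EuclideanSpace ℝ (Fin d) =>
      (((2 * Real.pi * ‖ξ‖) ^ (-(2 * s)) : ℝ) : ℂ) := by fun_prop
  have e : ∀ᵐ ξ : EuclideanSpace ℝ (Fin d), ∫ t in Ioi (0 : ℝ),
      ‖((t ^ (s - 1) * Real.exp (-(4 * Real.pi ^ 2 * t) * ‖ξ‖ ^ 2) : ℝ) : ℂ) * F ξ‖ =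
      Real.Gamma s * ‖(((2 * Real.pi * ‖ξ‖) ^ (-(2 * s)) : ℝ) : ℂ) * F ξ‖ := by
    filter_upwards [ae_ne_zero] with ξ hξ
    have : ∀ t ∈ Ioi (0 : ℝ),
        ‖((t ^ (s - 1) * Real.exp (-(4 * Real.pi ^ 2 * t) * ‖ξ‖ ^ 2) : ℝ) : ℂ) * F ξ‖ =
        t ^ (s - 1) * Real.exp (-(4 * Real.pi ^ 2 * t) * ‖ξ‖ ^ 2) * ‖F ξ‖ := by
      intro t ht
      have ht' : (0 : ℝ) < t := ht
      rw [norm_mul, Complex.norm_real, Real.norm_of_nonneg (by positivity)]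
    rw [setIntegral_congr_fun measurableSet_Ioi this, integral_mul_const,
      (integral_rpow_mul_exp_neg_norm_sq hs hξ).2, norm_mul, Complex.norm_real,
      Real.norm_of_nonneg (by positivity)]
    ring
  have mF : AEStronglyMeasurable (fun z : ℝ × EuclideanSpace ℝ (Fin d) =>
      ((z.1 ^ (s - 1) * Real.exp (-(4 * Real.pi ^ 2 * z.1) * ‖z.2‖ ^ 2) : ℝ) : ℂ) * F z.2)
      ((volume.restrict (Ioi (0 : ℝ))).prod volume) := m.aestronglyMeasurable.mul hF.comp_snd
  rw [integrable_prod_iff' mF, integrable_congr e]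
  constructor
  · rintro ⟨-, h⟩
    rw [integrable_const_mul_iff (Ne.isUnit hG.ne')] at h
    exact (integrable_norm_iff (mw.aestronglyMeasurable.mul hF)).1 h
  · intro h
    refine ⟨?_, h.norm.const_mul _⟩
    filter_upwards [ae_ne_zero] with ξ hξ
    exact (Integrable.ofReal (𝕜 := ℂ) (integral_rpow_mul_exp_neg_norm_sq hs hξ).1).mul_const _

theorem integral_rpow_mul_integral_exp [NeZero d] (hs : 0 < s)
    {F : EuclideanSpace ℝ (Fin d) → ℂ} (hF : AEStronglyMeasurable F)
    (hW : Integrable fun ξ => (((2 * Real.pi * ‖ξ‖) ^ (-(2 * s)) : ℝ) : ℂ) * F ξ) :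
    ∫ t in Ioi (0 : ℝ), ((t ^ (s - 1) : ℝ) : ℂ) *
      ∫ ξ, (Real.exp (-(4 * Real.pi ^ 2 * t) * ‖ξ‖ ^ 2) : ℂ) * F ξ =
    Real.Gamma s * ∫ ξ, (((2 * Real.pi * ‖ξ‖) ^ (-(2 * s)) : ℝ) : ℂ) * F ξ := by
  have i := (integrable_rpow_mul_exp_prod_iff hs hF).2 hW
  have e1 : ∀ t : ℝ, ((t ^ (s - 1) : ℝ) : ℂ) *
      ∫ ξ, (Real.exp (-(4 * Real.pi ^ 2 * t) * ‖ξ‖ ^ 2) : ℂ) * F ξ =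
      ∫ ξ, ((t ^ (s - 1) * Real.exp (-(4 * Real.pi ^ 2 * t) * ‖ξ‖ ^ 2) : ℝ) : ℂ) * F ξ := by
    intro t
    rw [← integral_const_mul]
    congr 1
    ext ξ
    push_cast
    ring
  simp_rw [e1]
  rw [integral_integral_swap (f := fun (t : ℝ) (ξ : EuclideanSpace ℝ (Fin d)) =>
    ((t ^ (s - 1) * Real.exp (-(4 * Real.pi ^ 2 * t) * ‖ξ‖ ^ 2) : ℝ) : ℂ) * F ξ) i,
    ← integral_const_mul]
  refine integral_congr_ae ?_
  filter_upwards [ae_ne_zero] with ξ hξ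
  rw [integral_mul_const, integral_complex_ofReal, (integral_rpow_mul_exp_neg_norm_sq hs hξ).2]
  push_cast
  ring

/-- Parseval's identity for the Riesz kernel. -/
theorem integral_rieszKernel_mul_mul [NeZero d] (hs : 0 < s) (hsd : s < (d : ℝ) / 2)
    (hf : Integrable f) (hk : Integrable k)
    (hI : Integrable fun p : EuclideanSpace ℝ (Fin d) × EuclideanSpace ℝ (Fin d) =>
      (rieszKernel d (2 * s) (p.1 - p.2) : ℂ) * (f p.1 * k p.2))
    (hW : Integrable fun ξ => (((2 * Real.pi * ‖ξ‖) ^ (-(2 * s)) : ℝ) : ℂ) * (𝓕 f ξ * 𝓕 k (-ξ))) :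
    ∫ p : EuclideanSpace ℝ (Fin d) × EuclideanSpace ℝ (Fin d),
      (rieszKernel d (2 * s) (p.1 - p.2) : ℂ) * (f p.1 * k p.2) =
    ∫ ξ, (((2 * Real.pi * ‖ξ‖) ^ (-(2 * s)) : ℝ) : ℂ) * (𝓕 f ξ * 𝓕 k (-ξ)) := by
  have hG : (Real.Gamma s : ℂ) ≠ 0 := by exact_mod_cast (Real.Gamma_pos_of_pos hs).ne'
  have hF : Continuous fun ξ => 𝓕 f ξ * 𝓕 k (-ξ) :=
    (continuous_fourier_of_integrable hf).mul
      ((continuous_fourier_of_integrable hk).comp continuous_neg)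
  have h1 := (integral_rpow_mul_heat_fourier hs hsd hf hk hI).2
  rw [integral_rpow_mul_integral_exp hs hF.aestronglyMeasurable hW] at h1
  exact (mul_left_cancel₀ hG h1).symm

/-- The Fourier transform of a real function is Hermitian. -/
theorem fourier_ofReal_neg (f : EuclideanSpace ℝ (Fin d) → ℝ) (ξ : EuclideanSpace ℝ (Fin d)) :
    𝓕 (fun x => (f x : ℂ)) (-ξ) = conj (𝓕 (fun x => (f x : ℂ)) ξ) := by
  rw [Real.fourier_eq', Real.fourier_eq', ← integral_conj]
  congr 1
  ext x
  simp only [smul_eq_mul, map_mul, ← Complex.exp_conj, Complex.conj_ofReal, Complex.conj_I,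
    inner_neg_right]
  congr 2
  push_cast
  ring

/-- For integrable real functions of finite energy, the weighted `L²` norm of the Fourier
transform is finite. -/
theorem integrable_weight_mul_normSq_fourier [NeZero d] (hs : 0 < s) (hsd : s < (d : ℝ) / 2)
    {f : EuclideanSpace ℝ (Fin d) → ℝ} (hf : Integrable f)
    (hI : Integrable fun p : EuclideanSpace ℝ (Fin d) × EuclideanSpace ℝ (Fin d) =>
      rieszKernel d (2 * s) (p.1 - p.2) * (f p.1 * f p.2)) :
    Integrable (fun ξ => (2 * Real.pi * ‖ξ‖) ^ (-(2 * s)) * ‖𝓕 (fun x => (f x : ℂ)) ξ‖ ^ 2) ∧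
    ∫ p : EuclideanSpace ℝ (Fin d) × EuclideanSpace ℝ (Fin d),
      rieszKernel d (2 * s) (p.1 - p.2) * (f p.1 * f p.2) =
    ∫ ξ, (2 * Real.pi * ‖ξ‖) ^ (-(2 * s)) * ‖𝓕 (fun x => (f x : ℂ)) ξ‖ ^ 2 := by
  set g : EuclideanSpace ℝ (Fin d) → ℂ := fun x => (f x : ℂ) with hg
  have ig : Integrable g := hf.ofReal
  have cg := continuous_fourier_of_integrable ig
  have e : ∀ ξ, 𝓕 g ξ * 𝓕 g (-ξ) = ((‖𝓕 g ξ‖ ^ 2 : ℝ) : ℂ) := by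
    intro ξ
    rw [fourier_ofReal_neg f ξ, Complex.mul_conj, Complex.normSq_eq_norm_sq]
  have hI' : Integrable fun p : EuclideanSpace ℝ (Fin d) × EuclideanSpace ℝ (Fin d) =>
      (rieszKernel d (2 * s) (p.1 - p.2) : ℂ) * (g p.1 * g p.2) := by
    refine hI.ofReal (𝕜 := ℂ) |>.congr (Eventually.of_forall fun p => ?_)
    simp [hg]
  have hF : AEStronglyMeasurable (fun ξ => 𝓕 g ξ * 𝓕 g (-ξ)) volume :=
    (cg.mul (cg.comp continuous_neg)).aestronglyMeasurable
  have hW : Integrable fun ξ => (((2 * Real.pi * ‖ξ‖) ^ (-(2 * s)) : ℝ) : ℂ) *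
      (𝓕 g ξ * 𝓕 g (-ξ)) := by
    -- Finiteness of the weighted norm is not known in advance. For equal arguments the integrand in
    -- `ξ` is nonnegative up to the weight in `t`, so the integral of its norm is the norm of its
    -- integral, whose integrability in `t` follows from finite energy.
    rw [← integrable_rpow_mul_exp_prod_iff hs hF, integrable_prod_iff]
    · constructor
      · refine (ae_restrict_iff' measurableSet_Ioi).2 (Eventually.of_forall fun t ht => ?_)
        have ht' : (0 : ℝ) < t := ht
        have hb : 0 < 4 * Real.pi ^ 2 * t := by positivity
        refine Integrable.mul_bdd (c := (∫ x, ‖g x‖) * ∫ x, ‖g x‖)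
          ((integrable_rexp_neg_mul_sq_norm hb).const_mul (t ^ (s - 1))).ofReal hF
          (Eventually.of_forall fun ξ => ?_)
        rw [norm_mul]
        exact mul_le_mul (norm_fourier_le _ _) (norm_fourier_le _ _) (norm_nonneg _)
          (integral_nonneg fun _ => norm_nonneg _)
      · refine IntegrableOn.congr_fun
          (integral_rpow_mul_heat_fourier hs hsd ig ig hI').1.norm (fun t ht => ?_)
          measurableSet_Ioi
        have ht' : (0 : ℝ) < t := ht
        simp_rw [e]
        have e2 : ∀ ξ, ‖((t ^ (s - 1) * Real.exp (-(4 * Real.pi ^ 2 * t) * ‖ξ‖ ^ 2) : ℝ) : ℂ) *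
            ((‖𝓕 g ξ‖ ^ 2 : ℝ) : ℂ)‖ = t ^ (s - 1) *
            (Real.exp (-(4 * Real.pi ^ 2 * t) * ‖ξ‖ ^ 2) * ‖𝓕 g ξ‖ ^ 2) := by
          intro ξ
          rw [← Complex.ofReal_mul, Complex.norm_real, Real.norm_of_nonneg (by positivity), mul_assoc]
        simp_rw [e2]
        rw [integral_const_mul, norm_mul, Complex.norm_real, Real.norm_of_nonneg (by positivity)]
        congr 1
        simp_rw [← Complex.ofReal_mul]
        rw [integral_complex_ofReal, Complex.norm_real, Real.norm_of_nonneg]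
        exact integral_nonneg fun ξ => by positivity
    · refine AEStronglyMeasurable.mul ?_ hF.comp_snd
      exact Measurable.aestronglyMeasurable (by fun_prop)
  have hW' : Integrable (fun ξ => (2 * Real.pi * ‖ξ‖) ^ (-(2 * s)) * ‖𝓕 g ξ‖ ^ 2) := by
    have := hW.re
    refine this.congr (Eventually.of_forall fun ξ => ?_)
    simp only [e]
    rw [← Complex.ofReal_mul]
    exact Complex.ofReal_re _
  refine ⟨hW', ?_⟩
  have h := integral_rieszKernel_mul_mul hs hsd ig ig hI' hW
  simp_rw [e, hg, ← Complex.ofReal_mul] at h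
  rw [integral_complex_ofReal, integral_complex_ofReal] at h
  exact_mod_cast h

end fourier
end

/-! ### Power weights against Schwartz functions. -/

noncomputable section
section weights

variable {d : ℕ}

/-- In polar coordinates the radial integrand is a multiple of `r^(d-1+a)`, whose exponent exceeds
`-1`. -/
theorem integrableOn_ball_norm_rpow [NeZero d] {a : ℝ} (ha : -(d : ℝ) < a) :
    IntegrableOn (fun ξ : EuclideanSpace ℝ (Fin d) => (2 * Real.pi * ‖ξ‖) ^ a)
      (Metric.ball 0 1) := by
  have h1 := integrableOn_fun_norm_addHaar (E := EuclideanSpace ℝ (Fin d)) volume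
    (f := fun r : ℝ => (2 * Real.pi * r) ^ a) (r := 1)
  refine h1.2 ?_
  rw [finrank_euclideanSpace_fin]
  have hd : 1 ≤ d := Nat.one_le_iff_ne_zero.2 (NeZero.ne d)
  have e : ∀ y ∈ Ioo (0 : ℝ) 1, (2 * Real.pi) ^ a * y ^ ((d : ℝ) - 1 + a) =
      y ^ (d - 1) • (2 * Real.pi * y) ^ a := by
    intro y hy
    rw [smul_eq_mul, Real.mul_rpow (by positivity) hy.1.le, Real.rpow_add hy.1,
      ← Real.rpow_natCast, Nat.cast_sub hd]
    push_cast
    ring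
  refine IntegrableOn.congr_fun (Integrable.const_mul ?_ _) e measurableSet_Ioo
  have := intervalIntegral.intervalIntegrable_rpow' (a := 0) (b := 1)
    (r := (d : ℝ) - 1 + a) (by linarith)
  rw [intervalIntegrable_iff_integrableOn_Ioo_of_le zero_le_one] at this
  exact this

theorem exists_norm_le_schwartz (φ : 𝓢(EuclideanSpace ℝ (Fin d), ℂ)) :
    ∃ C : ℝ, 0 ≤ C ∧ ∀ x, ‖φ x‖ ≤ C := by
  obtain ⟨C, hC, h⟩ := φ.decay 0 0
  exact ⟨C, hC.le, fun x => by simpa using h x⟩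

theorem integrable_norm_rpow_mul_schwartz [NeZero d] {a : ℝ} (ha : -(d : ℝ) < a)
    (φ : 𝓢(EuclideanSpace ℝ (Fin d), ℂ)) :
    Integrable fun ξ => (2 * Real.pi * ‖ξ‖) ^ a * ‖φ ξ‖ := by
  obtain ⟨C, hC, hφ⟩ := exists_norm_le_schwartz φ
  -- Outside the unit ball `2π‖ξ‖ ≥ 1`, so the weight is at most its `N`-th power, which Schwartz
  -- decay absorbs.
  set N := ⌈|a|⌉₊ with hN
  have i1 : Integrable ((Metric.ball (0 : EuclideanSpace ℝ (Fin d)) 1).indicator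
      fun ξ => (2 * Real.pi * ‖ξ‖) ^ a * C) :=
    (integrable_indicator_iff measurableSet_ball).2 ((integrableOn_ball_norm_rpow ha).mul_const C)
  have i2 := (φ.integrable_pow_mul volume N).const_mul ((2 * Real.pi) ^ N)
  refine (i1.add i2).mono' ?_ (Eventually.of_forall fun ξ => ?_)
  · exact AEStronglyMeasurable.mul (Measurable.aestronglyMeasurable (by fun_prop))
      φ.continuous.norm.aestronglyMeasurable
  · rw [Real.norm_of_nonneg (by positivity), Pi.add_apply]
    by_cases hξ : ξ ∈ Metric.ball (0 : EuclideanSpace ℝ (Fin d)) 1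
    · rw [indicator_of_mem hξ]
      have : 0 ≤ (2 * Real.pi) ^ N * (‖ξ‖ ^ N * ‖φ ξ‖) := by positivity
      have h2 : (2 * Real.pi * ‖ξ‖) ^ a * ‖φ ξ‖ ≤ (2 * Real.pi * ‖ξ‖) ^ a * C := by
        gcongr; exact hφ ξ
      linarith
    · rw [indicator_of_notMem hξ, zero_add, ← mul_assoc, ← mul_pow]
      have h1 : 1 ≤ ‖ξ‖ := by simpa using hξ
      have h2 : 1 ≤ 2 * Real.pi * ‖ξ‖ := by nlinarith [Real.pi_gt_three]
      refine mul_le_mul_of_nonneg_right ?_ (norm_nonneg _)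
      rw [← Real.rpow_natCast]
      exact Real.rpow_le_rpow_of_exponent_le h2 ((le_abs_self a).trans (Nat.le_ceil _))

theorem integrable_norm_rpow_mul_schwartz_sq [NeZero d] {a : ℝ} (ha : -(d : ℝ) < a)
    (φ : 𝓢(EuclideanSpace ℝ (Fin d), ℂ)) :
    Integrable fun ξ => (2 * Real.pi * ‖ξ‖) ^ a * ‖φ ξ‖ ^ 2 := by
  obtain ⟨C, hC, hφ⟩ := exists_norm_le_schwartz φ
  refine ((integrable_norm_rpow_mul_schwartz ha φ).const_mul C).mono' ?_
    (Eventually.of_forall fun ξ => ?_)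
  · exact AEStronglyMeasurable.mul (Measurable.aestronglyMeasurable (by fun_prop))
      (φ.continuous.norm.pow 2).aestronglyMeasurable
  · rw [Real.norm_of_nonneg (by positivity), sq]
    have : 0 ≤ (2 * Real.pi * ‖ξ‖) ^ a * ‖φ ξ‖ := by positivity
    nlinarith [hφ ξ]

theorem norm_weight_mul_sq (a : ℝ) (ξ : EuclideanSpace ℝ (Fin d)) (z : ℂ) :
    ‖(((2 * Real.pi * ‖ξ‖) ^ a : ℝ) : ℂ) * z‖ ^ 2 = (2 * Real.pi * ‖ξ‖) ^ (2 * a) * ‖z‖ ^ 2 := by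
  rw [norm_mul, Complex.norm_real, Real.norm_of_nonneg (by positivity), mul_pow,
    ← Real.rpow_natCast, ← Real.rpow_mul (by positivity), mul_comm a]
  rfl

theorem memLp_two_weight_mul_iff {a : ℝ} {g : EuclideanSpace ℝ (Fin d) → ℂ}
    (hg : AEStronglyMeasurable g) :
    MemLp (fun ξ => (((2 * Real.pi * ‖ξ‖) ^ a : ℝ) : ℂ) * g ξ) 2 ↔
      Integrable fun ξ => (2 * Real.pi * ‖ξ‖) ^ (2 * a) * ‖g ξ‖ ^ 2 := by
  rw [memLp_two_iff_integrable_sq_norm]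
  · simp_rw [norm_weight_mul_sq]
  · exact AEStronglyMeasurable.mul (Measurable.aestronglyMeasurable (by fun_prop)) hg

theorem memLp_two_weight_mul_schwartz [NeZero d] {a : ℝ} (ha : -(d : ℝ) / 2 < a)
    (φ : 𝓢(EuclideanSpace ℝ (Fin d), ℂ)) :
    MemLp (fun ξ => (((2 * Real.pi * ‖ξ‖) ^ a : ℝ) : ℂ) * φ ξ) 2 :=
  (memLp_two_weight_mul_iff φ.continuous.aestronglyMeasurable).2
    (integrable_norm_rpow_mul_schwartz_sq (by linarith) φ)

theorem weight_neg_mul_weight (a : ℝ) {ξ : EuclideanSpace ℝ (Fin d)} (hξ : ξ ≠ 0) :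
    (2 * Real.pi * ‖ξ‖) ^ (-a) * (2 * Real.pi * ‖ξ‖) ^ a = 1 := by
  have : 0 < ‖ξ‖ := norm_pos_iff.2 hξ
  rw [← Real.rpow_add (by positivity), neg_add_cancel, Real.rpow_zero]

end weights

/-! ### Test functions and Hermitian symmetry. -/

section testFunctions

variable {d : ℕ} {s : ℝ}

/-- A real test function as a complex Schwartz function. -/
def testToSchwartz {φ : EuclideanSpace ℝ (Fin d) → ℝ} (hφ : ContDiff ℝ ∞ φ)
    (hc : HasCompactSupport φ) : 𝓢(EuclideanSpace ℝ (Fin d), ℂ) :=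
  (hc.comp_left (g := fun r : ℝ => (r : ℂ)) rfl).toSchwartzMap
    (Complex.ofRealCLM.contDiff.comp hφ)

@[simp]
theorem testToSchwartz_apply {φ : EuclideanSpace ℝ (Fin d) → ℝ} (hφ : ContDiff ℝ ∞ φ)
    (hc : HasCompactSupport φ) (x : EuclideanSpace ℝ (Fin d)) :
    testToSchwartz hφ hc x = (φ x : ℂ) := rfl

theorem integral_fourier_mul_eq_of_integrable {f g : EuclideanSpace ℝ (Fin d) → ℂ}
    (hf : Integrable f) (hg : Integrable g) : ∫ ξ, 𝓕 f ξ * g ξ = ∫ x, f x * 𝓕 g x := by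
  simpa using! VectorFourier.integral_fourierIntegral_smul_eq_flip (L := innerₗ _)
    Real.continuous_fourierChar continuous_inner hf hg

/-- The Fourier transform is injective on `L¹`. -/
theorem ae_eq_zero_of_fourier_eq_zero {G : EuclideanSpace ℝ (Fin d) → ℂ} (hG : Integrable G)
    (h : ∀ a, 𝓕 G a = 0) : ∀ᵐ ξ, G ξ = 0 := by
  refine ae_eq_zero_of_integral_contDiff_smul_eq_zero hG.locallyIntegrable fun φ hφ hc => ?_
  set ψ : 𝓢(EuclideanSpace ℝ (Fin d), ℂ) := 𝓕⁻ (testToSchwartz hφ hc) with hψ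
  have h1 : (𝓕 (ψ : EuclideanSpace ℝ (Fin d) → ℂ)) = fun x => (φ x : ℂ) := by
    have : 𝓕 ψ = testToSchwartz hφ hc := FourierTransform.fourier_fourierInv_eq _
    rw [← SchwartzMap.fourier_coe, this]
    rfl
  have h2 := integral_fourier_mul_eq_of_integrable ψ.integrable hG
  rw [h1] at h2
  simp_rw [Complex.real_smul]
  rw [h2]
  simp [h]

theorem fourier_comp_neg (f : EuclideanSpace ℝ (Fin d) → ℂ) (ξ : EuclideanSpace ℝ (Fin d)) :
    𝓕 (fun x => f (-x)) ξ = 𝓕 f (-ξ) := by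
  rw [Real.fourier_eq', Real.fourier_eq',
    ← integral_neg_eq_self (fun x => Complex.exp (↑(-2 * Real.pi * inner ℝ x (-ξ)) * Complex.I) • f x)]
  simp

/-- For real `φ`, reflecting `φ` conjugates its Fourier transform; since `u` is real, the symmetry
passes to `g` by duality. It is needed because density has to be proved in a space of real
functions, while transforms live in complex `L²`. -/
theorem IsDistribFourier.ae_neg {u : EuclideanSpace ℝ (Fin d) → ℝ}
    {g : EuclideanSpace ℝ (Fin d) → ℂ} (hg : IsDistribFourier u g) :
    ∀ᵐ ξ, g (-ξ) = conj (g ξ) := by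
  have l1 : LocallyIntegrable fun ξ => g (-ξ) := by
    intro x
    obtain ⟨U, hU, hi⟩ := hg.1 (-x)
    refine ⟨-U, ?_, ?_⟩
    · exact continuous_neg.continuousAt.preimage_mem_nhds hU
    · have := (Measure.measurePreserving_neg (volume : Measure (EuclideanSpace ℝ (Fin d))))
      rw [← this.integrableOn_comp_preimage (MeasurableEquiv.neg _).measurableEmbedding] at hi
      exact hi
  have l2 : LocallyIntegrable fun ξ => conj (g ξ) := by
    intro x
    obtain ⟨U, hU, hi⟩ := hg.1 x
    refine ⟨U, hU, ?_⟩
    refine (integrable_norm_iff ?_).1 ?_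
    · exact Complex.continuous_conj.comp_aestronglyMeasurable hi.1
    · simpa using hi.norm
  refine ae_eq_of_integral_contDiff_smul_eq l1 l2 fun φ hφ hc => ?_
  have hφ' : ContDiff ℝ ∞ fun x => φ (-x) := hφ.comp contDiff_neg
  have hc' : HasCompactSupport fun x => φ (-x) := hc.comp_homeomorph (Homeomorph.neg _)
  have e1 := (hg.2 (testToSchwartz hφ hc)).2.2
  have e2 := (hg.2 (testToSchwartz hφ' hc')).2.2
  have e3 : ∀ x, (𝓕 (testToSchwartz hφ' hc')) x = conj ((𝓕 (testToSchwartz hφ hc)) x) := by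
    intro x
    rw [SchwartzMap.fourier_coe, SchwartzMap.fourier_coe]
    exact (fourier_comp_neg (fun x => (φ x : ℂ)) x).trans (fourier_ofReal_neg φ x)
  calc ∫ ξ, φ ξ • g (-ξ) = ∫ ξ, φ (-ξ) • g ξ := by
        rw [← integral_neg_eq_self]; simp
    _ = ∫ ξ, g ξ * (testToSchwartz hφ' hc') ξ := by
        congr 1; ext ξ; simp [mul_comm]
    _ = ∫ x, (u x : ℂ) * conj ((𝓕 (testToSchwartz hφ hc)) x) := by
        rw [e2]; simp_rw [e3]
    _ = conj (∫ ξ, g ξ * (testToSchwartz hφ hc) ξ) := by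
        rw [e1, ← integral_conj]; simp
    _ = ∫ ξ, φ ξ • conj (g ξ) := by
        rw [← integral_conj]; simp [mul_comm]

theorem isDistribFourier_test {φ : EuclideanSpace ℝ (Fin d) → ℝ} (hφ : ContDiff ℝ ∞ φ)
    (hc : HasCompactSupport φ) :
    IsDistribFourier φ (𝓕 (testToSchwartz hφ hc) : 𝓢(EuclideanSpace ℝ (Fin d), ℂ)) := by
  set Φ := testToSchwartz hφ hc with hΦ
  refine ⟨(𝓕 Φ).integrable.locallyIntegrable, fun ψ => ⟨?_, ?_, ?_⟩⟩
  · obtain ⟨C, hC, h⟩ := exists_norm_le_schwartz (𝓕 ψ)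
    exact Φ.integrable.mul_bdd (𝓕 ψ).continuous.aestronglyMeasurable (Eventually.of_forall h)
  · obtain ⟨C, hC, h⟩ := exists_norm_le_schwartz ψ
    exact (𝓕 Φ).integrable.mul_bdd ψ.continuous.aestronglyMeasurable (Eventually.of_forall h)
  · exact SchwartzMap.integral_fourier_mul_eq Φ ψ

theorem hasFiniteHomNorm_test [NeZero d] (hs : 0 < s) {φ : EuclideanSpace ℝ (Fin d) → ℝ}
    (hφ : ContDiff ℝ ∞ φ) (hc : HasCompactSupport φ) : HasFiniteHomNorm s φ :=
  ⟨(𝓕 (testToSchwartz hφ hc) : 𝓢(EuclideanSpace ℝ (Fin d), ℂ)), isDistribFourier_test hφ hc,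
    integrable_norm_rpow_mul_schwartz_sq
      (by have : 0 ≤ (d : ℝ) := Nat.cast_nonneg d; linarith) _⟩

namespace HomSobolev

/-- The element of `H̊ˢ` given by a function in `L^p` of finite norm. -/
def ofMemLp {u : EuclideanSpace ℝ (Fin d) → ℝ}
    (hu : MemLp u (ENNReal.ofReal (2 * d / (d - 2 * s)))) (h : HasFiniteHomNorm s u) :
    HomSobolev d s :=
  (⟨hu.toLp u, h.congr hu.coeFn_toLp.symm⟩ : homSobolevSubmodule d s)

theorem coeFn_ofMemLp {u : EuclideanSpace ℝ (Fin d) → ℝ}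
    (hu : MemLp u (ENNReal.ofReal (2 * d / (d - 2 * s)))) (h : HasFiniteHomNorm s u) :
    ofMemLp hu h =ᵐ[volume] u :=
  hu.coeFn_toLp

theorem ext_ae {u v : HomSobolev d s} (h : u =ᵐ[volume] v) : u = v :=
  Subtype.ext (Lp.ext h)

theorem fourier_ae_eq {u : HomSobolev d s} {v : EuclideanSpace ℝ (Fin d) → ℝ}
    {g : EuclideanSpace ℝ (Fin d) → ℂ} (huv : u =ᵐ[volume] v) (hg : IsDistribFourier v g) :
    u.fourier =ᵐ[volume] g :=
  u.isDistribFourier_fourier.unique (hg.congr huv.symm)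

theorem exists_test [NeZero d] (hs : 0 < s) {φ : EuclideanSpace ℝ (Fin d) → ℝ}
    (hφ : ContDiff ℝ ∞ φ) (hc : HasCompactSupport φ) : ∃ u : HomSobolev d s, u =ᵐ[volume] φ :=
  ⟨ofMemLp (hφ.continuous.memLp_of_hasCompactSupport hc) (hasFiniteHomNorm_test hs hφ hc),
    coeFn_ofMemLp _ _⟩

end HomSobolev

end testFunctions
end

/-! ### The isometry into `L²`, definiteness, and density of test functions. -/

noncomputable section

variable {d : ℕ} {s : ℝ}

namespace HomSobolev

theorem memLp_weight_mul_fourier (u : HomSobolev d s) :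
    MemLp (fun ξ => (((2 * Real.pi * ‖ξ‖) ^ s : ℝ) : ℂ) * u.fourier ξ) 2 :=
  (memLp_two_weight_mul_iff u.isDistribFourier_fourier.1.aestronglyMeasurable).2
    u.integrable_fourier

/-- The isometry `u ↦ |ξ|^s û` of `H̊ˢ` into `L²`. -/
def toL2 (d : ℕ) (s : ℝ) :
    HomSobolev d s →ₗᵢ[ℝ] Lp (α := EuclideanSpace ℝ (Fin d)) ℂ 2 volume where
  toFun u := u.memLp_weight_mul_fourier.toLp _
  map_add' u v := by
    refine Lp.ext ?_
    filter_upwards [(u + v).memLp_weight_mul_fourier.coeFn_toLp,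
      u.memLp_weight_mul_fourier.coeFn_toLp, v.memLp_weight_mul_fourier.coeFn_toLp,
      Lp.coeFn_add (u.memLp_weight_mul_fourier.toLp _) (v.memLp_weight_mul_fourier.toLp _),
      fourier_add u v] with ξ h1 h2 h3 h4 h5
    rw [h1, h4, Pi.add_apply, h2, h3, h5, Pi.add_apply, mul_add]
  map_smul' r u := by
    refine Lp.ext ?_
    filter_upwards [(r • u).memLp_weight_mul_fourier.coeFn_toLp,
      u.memLp_weight_mul_fourier.coeFn_toLp,
      Lp.coeFn_smul r (u.memLp_weight_mul_fourier.toLp _), fourier_smul r u] with ξ h1 h2 h3 h4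
    rw [RingHom.id_apply, h1, h3, Pi.smul_apply, h2, h4, Pi.smul_apply, mul_smul_comm]
  norm_map' u := by
    have h : ‖u.memLp_weight_mul_fourier.toLp _‖ ^ 2 = ‖u‖ ^ 2 := by
      rw [norm_sq_eq, ← real_inner_self_eq_norm_sq, L2.inner_def]
      refine integral_congr_ae ?_
      filter_upwards [u.memLp_weight_mul_fourier.coeFn_toLp] with ξ h1
      rw [h1, real_inner_self_eq_norm_sq, norm_weight_mul_sq]
    exact (pow_left_inj₀ (norm_nonneg _) (norm_nonneg _) two_ne_zero).1 h

theorem coeFn_toL2 (u : HomSobolev d s) : toL2 d s u =ᵐ[volume]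
    fun ξ => (((2 * Real.pi * ‖ξ‖) ^ s : ℝ) : ℂ) * u.fourier ξ :=
  u.memLp_weight_mul_fourier.coeFn_toLp

theorem coeFn_toL2_of_ae_eq {u : HomSobolev d s} {v : EuclideanSpace ℝ (Fin d) → ℝ}
    {g : EuclideanSpace ℝ (Fin d) → ℂ} (huv : u =ᵐ[volume] v) (hg : IsDistribFourier v g) :
    toL2 d s u =ᵐ[volume] fun ξ => (((2 * Real.pi * ‖ξ‖) ^ s : ℝ) : ℂ) * g ξ := by
  filter_upwards [u.coeFn_toL2, fourier_ae_eq huv hg] with ξ h1 h2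
  rw [h1, h2]

theorem memLp_coeFn (u : HomSobolev d s) :
    MemLp u (ENNReal.ofReal (2 * d / (d - 2 * s))) := Lp.memLp u.toLp

theorem one_le_exponent [NeZero d] (hs : 0 < s) (hsd : s < (d : ℝ) / 2) :
    1 ≤ ENNReal.ofReal (2 * d / (d - 2 * s)) := by
  rw [← ENNReal.ofReal_one]
  refine ENNReal.ofReal_le_ofReal ?_
  rw [le_div_iff₀ (by linarith)]
  have : 0 ≤ (d : ℝ) := Nat.cast_nonneg d
  linarith

/-- Definiteness of the norm, which the seminormed instance does not contain. The weight vanishes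
only at the origin, so `û = 0`; every test function is the transform of a Schwartz function, hence
`u` pairs to zero with all test functions. -/
theorem eq_zero_of_toL2_eq_zero [NeZero d] (hs : 0 < s) (hsd : s < (d : ℝ) / 2)
    {u : HomSobolev d s} (h : toL2 d s u = 0) : u = 0 := by
  have h1 : ∀ᵐ ξ, u.fourier ξ = 0 := by
    filter_upwards [u.coeFn_toL2, Lp.coeFn_zero ℂ 2 (volume : Measure (EuclideanSpace ℝ (Fin d))),
      ae_ne_zero] with ξ h2 h3 hξ
    rw [h, h3, Pi.zero_apply] at h2
    have : 0 < ‖ξ‖ := norm_pos_iff.2 hξ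
    have h4 : (((2 * Real.pi * ‖ξ‖) ^ s : ℝ) : ℂ) ≠ 0 := by
      exact_mod_cast (by positivity : (0 : ℝ) < (2 * Real.pi * ‖ξ‖) ^ s).ne'
    exact (mul_eq_zero.1 h2.symm).resolve_left h4
  have h2 : ∀ᵐ x, u x = 0 := by
    refine ae_eq_zero_of_integral_contDiff_smul_eq_zero
      (u.memLp_coeFn.locallyIntegrable (one_le_exponent hs hsd)) fun φ hφ hc => ?_
    have h3 := (u.isDistribFourier_fourier.2 (𝓕⁻ (testToSchwartz hφ hc))).2.2
    have h4 : 𝓕 (𝓕⁻ (testToSchwartz hφ hc)) = testToSchwartz hφ hc :=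
      FourierTransform.fourier_fourierInv_eq _
    rw [h4] at h3
    have h5 : ∫ ξ, u.fourier ξ * (𝓕⁻ (testToSchwartz hφ hc)) ξ = 0 := by
      refine integral_eq_zero_of_ae ?_
      filter_upwards [h1] with ξ hξ
      simp [hξ]
    rw [h5] at h3
    simp only [testToSchwartz_apply, ← Complex.ofReal_mul] at h3
    rw [integral_complex_ofReal] at h3
    have h6 := Complex.ofReal_eq_zero.1 h3.symm
    simpa [mul_comm] using h6
  refine ext_ae ?_
  filter_upwards [h2, Lp.coeFn_zero ℝ (ENNReal.ofReal (2 * d / (d - 2 * s)))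
    (volume : Measure (EuclideanSpace ℝ (Fin d)))] with x hx hx0
  rw [hx]
  exact hx0.symm

theorem eq_of_inner_eq [NeZero d] (hs : 0 < s) (hsd : s < (d : ℝ) / 2)
    {u v : HomSobolev d s} (h : ∀ w, inner ℝ u w = inner ℝ v w) : u = v := by
  rw [← sub_eq_zero]
  refine eq_zero_of_toL2_eq_zero hs hsd ?_
  rw [← norm_eq_zero, LinearIsometry.norm_map, ← sq_eq_zero_iff, ← real_inner_self_eq_norm_sq,
    inner_sub_left, h, sub_self]

end HomSobolev

/-- Pairing the Hermitian part of `h` with a Hermitian function. -/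
theorem integral_hermitianPart_mul_conj {h k : EuclideanSpace ℝ (Fin d) → ℂ}
    (hk : ∀ᵐ ξ, k (-ξ) = conj (k ξ)) (hi : Integrable fun ξ => h ξ * conj (k ξ)) :
    Integrable (fun ξ => (h ξ + conj (h (-ξ))) * conj (k ξ)) ∧
    ∫ ξ, (h ξ + conj (h (-ξ))) * conj (k ξ) = ((2 * ∫ ξ, (h ξ * conj (k ξ)).re : ℝ) : ℂ) := by
  have hk' : ∀ᵐ ξ, k ξ = conj (k (-ξ)) := by
    filter_upwards [hk] with ξ h1
    rw [h1, Complex.conj_conj]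
  have e : (fun ξ => conj (h (-ξ) * conj (k (-ξ)))) =ᵐ[volume]
      fun ξ => conj (h (-ξ)) * conj (k ξ) := by
    filter_upwards [hk'] with ξ h1
    rw [map_mul, ← h1]
  have i1 : Integrable (fun ξ => conj (h ξ * conj (k ξ))) :=
    (LinearIsometryEquiv.integrable_comp_iff (Complex.conjLIE)).2 hi
  have i2 : Integrable (fun ξ => conj (h (-ξ)) * conj (k ξ)) := i1.comp_neg.congr e
  constructor
  · refine (hi.add i2).congr (Eventually.of_forall fun ξ => ?_)
    simp [add_mul]
  · simp_rw [add_mul]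
    rw [integral_add hi i2, ← integral_congr_ae e,
      integral_neg_eq_self (fun ξ => conj (h ξ * conj (k ξ))), integral_conj, Complex.add_conj]
    congr 2
    exact (integral_re hi).symm

/-- There are test functions whose Fourier transform does not vanish on a given ball. -/
theorem exists_test_fourier_ne_zero {R : ℝ} (hR : 0 < R) :
    ∃ ρ : EuclideanSpace ℝ (Fin d) → ℝ, ContDiff ℝ ∞ ρ ∧ HasCompactSupport ρ ∧
      ∀ ξ, ‖ξ‖ < R → 𝓕 (fun x => (ρ x : ℂ)) ξ ≠ 0 := by
  -- On the support `‖x‖ ≤ 1/(8R)`, so for `‖ξ‖ < R` the phase is at most `π/4 < 1` in absolute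
  -- value. There the cosine is at least `1/2`, and the real part of the transform is at least half
  -- the mass of the bump.
  let b : ContDiffBump (0 : EuclideanSpace ℝ (Fin d)) :=
    ⟨1 / (16 * R), 1 / (8 * R), by positivity, by gcongr; norm_num⟩
  refine ⟨b, b.contDiff, b.hasCompactSupport, fun ξ hξ h0 => ?_⟩
  have ib : Integrable (fun x => b x) := b.integrable
  have ii : Integrable fun x : EuclideanSpace ℝ (Fin d) =>
      Complex.exp (↑(-2 * Real.pi * inner ℝ x ξ) * Complex.I) • ((b x : ℝ) : ℂ) := by
    refine Integrable.bdd_mul (c := 1) ib.ofReal ?_ (Eventually.of_forall fun p => ?_)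
    · exact Continuous.aestronglyMeasurable (by fun_prop)
    · rw [Complex.norm_exp_ofReal_mul_I]
  have h1 : (1 / 2) * ∫ x, b x ≤ (𝓕 (fun x => ((b x : ℝ) : ℂ)) ξ).re := by
    rw [Real.fourier_eq', ← integral_const_mul]
    have := integral_re ii
    simp only [RCLike.re_to_complex] at this
    rw [← this]
    refine integral_mono (ib.const_mul _) ii.re fun x => ?_
    simp only [smul_eq_mul, Complex.re_mul_ofReal, Complex.exp_ofReal_mul_I_re]
    by_cases hx : x ∈ Metric.ball (0 : EuclideanSpace ℝ (Fin d)) (1 / (8 * R))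
    · refine mul_le_mul_of_nonneg_right ?_ b.nonneg
      have hx' : ‖x‖ < 1 / (8 * R) := by simpa using hx
      have h2 : |inner ℝ x ξ| ≤ 1 / 8 := by
        refine (abs_real_inner_le_norm x ξ).trans ?_
        calc ‖x‖ * ‖ξ‖ ≤ 1 / (8 * R) * R := by gcongr
          _ = 1 / 8 := by field_simp
      have h3 : (-2 * Real.pi * inner ℝ x ξ) ^ 2 ≤ 1 := by
        rw [sq_le_one_iff_abs_le_one, abs_mul, abs_mul, abs_neg, abs_two, abs_of_pos Real.pi_pos]
        nlinarith [Real.pi_lt_four, Real.pi_pos, abs_nonneg (inner ℝ x ξ)]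
      linarith [Real.one_sub_sq_div_two_le_cos (x := -2 * Real.pi * inner ℝ x ξ)]
    · have : b x = 0 := by
        rw [← Function.notMem_support, b.support_eq]
        exact hx
      simp [this]
  have h2 : 0 < ∫ x, b x := b.integral_pos
  rw [h0, Complex.zero_re] at h1
  linarith

theorem fourier_comp_sub (f : EuclideanSpace ℝ (Fin d) → ℂ) (a ξ : EuclideanSpace ℝ (Fin d)) :
    𝓕 (fun x => f (x - a)) ξ =
      Complex.exp (↑(-2 * Real.pi * inner ℝ a ξ) * Complex.I) * 𝓕 f ξ := by
  rw [Real.fourier_eq', Real.fourier_eq', ← integral_const_mul,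
    ← integral_sub_right_eq_self (fun x => Complex.exp (↑(-2 * Real.pi * inner ℝ a ξ) * Complex.I) *
      Complex.exp (↑(-2 * Real.pi * inner ℝ x ξ) * Complex.I) • f x) a]
  congr 1
  ext x
  rw [smul_eq_mul, smul_eq_mul, ← mul_assoc, ← Complex.exp_add]
  congr 2
  rw [inner_sub_left]
  push_cast
  ring

/-- A weighted `L²` function orthogonal to the Fourier transforms of all test functions vanishes. -/
theorem ae_eq_zero_of_integral_weight_test_eq_zero [NeZero d] (hs : 0 < s)
    {F : EuclideanSpace ℝ (Fin d) → ℂ} (hF : MemLp F 2)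
    (h : ∀ φ (hφ : ContDiff ℝ ∞ φ) (hc : HasCompactSupport φ),
      ∫ ξ, F ξ * conj ((((2 * Real.pi * ‖ξ‖) ^ s : ℝ) : ℂ) *
        (𝓕 (testToSchwartz hφ hc) : 𝓢(EuclideanSpace ℝ (Fin d), ℂ)) ξ) = 0) :
    ∀ᵐ ξ, F ξ = 0 := by
  have key : ∀ n : ℕ, ∀ᵐ ξ, ‖ξ‖ < (n : ℝ) + 1 → F ξ = 0 := by
    intro n
    obtain ⟨ρ, hρ, hc, hne⟩ := exists_test_fourier_ne_zero (d := d) (R := n + 1) (by positivity)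
    set G : EuclideanSpace ℝ (Fin d) → ℂ := fun ξ =>
      F ξ * conj ((((2 * Real.pi * ‖ξ‖) ^ s : ℝ) : ℂ) *
        (𝓕 (testToSchwartz hρ hc) : 𝓢(EuclideanSpace ℝ (Fin d), ℂ)) ξ) with hG
    have hd : 0 ≤ (d : ℝ) := Nat.cast_nonneg d
    have iG : Integrable G := by
      have m := memLp_two_weight_mul_schwartz (a := s) (by linarith) (𝓕 (testToSchwartz hρ hc))
      exact hF.integrable_mul m.star
    -- Translating `ρ` multiplies its transform by a character, so orthogonality to all translates
    -- says that the Fourier transform of `G` vanishes. Then `G = 0`, and `F = 0` wherever the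
    -- transform of `ρ` is nonzero.
    have hz := ae_eq_zero_of_fourier_eq_zero iG fun b => by
      have hρ' : ContDiff ℝ ∞ fun x => ρ (x - -b) := hρ.comp (contDiff_id.sub contDiff_const)
      have hc' : HasCompactSupport fun x => ρ (x - -b) :=
        hc.comp_homeomorph (Homeomorph.subRight (-b))
      rw [Real.fourier_eq', ← h _ hρ' hc']
      congr 1
      ext ξ
      have e : (𝓕 (testToSchwartz hρ' hc') : 𝓢(EuclideanSpace ℝ (Fin d), ℂ)) ξ =
          Complex.exp (↑(-2 * Real.pi * inner ℝ (-b) ξ) * Complex.I) *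
            (𝓕 (testToSchwartz hρ hc) : 𝓢(EuclideanSpace ℝ (Fin d), ℂ)) ξ := by
        rw [SchwartzMap.fourier_coe, SchwartzMap.fourier_coe]
        exact fourier_comp_sub (fun x => (ρ x : ℂ)) (-b) ξ
      simp only [hG]
      rw [e]
      simp only [map_mul, ← Complex.exp_conj, Complex.conj_ofReal, Complex.conj_I, smul_eq_mul,
        inner_neg_left]
      rw [real_inner_comm]
      have e2 : Complex.exp (↑(-2 * Real.pi * inner ℝ b ξ) * Complex.I) =
        Complex.exp (↑(-2 * Real.pi * -inner ℝ b ξ) * -Complex.I) := by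
        congr 1; push_cast; ring
      rw [e2]
      ring
    filter_upwards [hz, ae_ne_zero] with ξ h1 h2 h3
    have h4 : 0 < ‖ξ‖ := norm_pos_iff.2 h2
    refine (mul_eq_zero.1 h1).resolve_right ?_
    rw [← ne_eq, map_ne_zero]
    refine mul_ne_zero ?_ (hne ξ h3)
    exact_mod_cast (by positivity : (0 : ℝ) < (2 * Real.pi * ‖ξ‖) ^ s).ne'
  filter_upwards [ae_all_iff.2 key] with ξ hξ
  obtain ⟨n, hn⟩ := exists_nat_gt ‖ξ‖
  exact hξ n (by linarith)

namespace HomSobolev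

/-- Test functions are dense in `H̊ˢ`. -/
theorem dense_test [NeZero d] (hs : 0 < s) (u : HomSobolev d s) :
    u ∈ closure (Submodule.span ℝ {v : HomSobolev d s |
      ∃ φ : EuclideanSpace ℝ (Fin d) → ℝ, ContDiff ℝ ∞ φ ∧ HasCompactSupport φ ∧
        v =ᵐ[volume] φ} : Set (HomSobolev d s)) := by
  set S := Submodule.span ℝ {v : HomSobolev d s |
      ∃ φ : EuclideanSpace ℝ (Fin d) → ℝ, ContDiff ℝ ∞ φ ∧ HasCompactSupport φ ∧
        v =ᵐ[volume] φ} with hS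
  rw [(toL2 d s).isometry.isUniformInducing.isInducing.closure_eq_preimage_closure_image,
    mem_preimage]
  -- The closure is computed in `L²`, which is complete; completeness of `HomSobolev d s` plays no
  -- role.
  suffices hu : toL2 d s u ∈ (S.map (toL2 d s).toLinearMap)ᗮᗮ by
    rw [Submodule.orthogonal_orthogonal_eq_closure] at hu
    exact hu
  rw [Submodule.mem_orthogonal']
  intro h hh
  rw [Submodule.mem_orthogonal] at hh
  -- Orthogonality holds only for the real inner product, so `h` itself need not vanish. Pairing `F`
  -- with a Hermitian function gives twice the real inner product with `h`, hence `F` is orthogonal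
  -- in the complex sense and must vanish.
  set F : EuclideanSpace ℝ (Fin d) → ℂ := fun ξ => h ξ + conj (h (-ξ)) with hF
  have mh : MemLp h 2 := Lp.memLp h
  have mF : MemLp F 2 :=
    mh.add (mh.comp_measurePreserving (Measure.measurePreserving_neg _)).star
  have herm : ∀ v : HomSobolev d s, ∀ᵐ ξ, toL2 d s v (-ξ) = conj (toL2 d s v ξ) := by
    intro v
    have h1 := (Measure.measurePreserving_neg
      (volume : Measure (EuclideanSpace ℝ (Fin d)))).quasiMeasurePreserving.ae v.coeFn_toL2
    filter_upwards [v.coeFn_toL2, h1, v.isDistribFourier_fourier.ae_neg] with ξ h2 h3 h4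
    rw [h2, h3, h4, norm_neg, map_mul, Complex.conj_ofReal]
  have pair : ∀ v : HomSobolev d s, ∫ ξ, F ξ * conj (toL2 d s v ξ) =
      ((2 * inner ℝ (toL2 d s v) h : ℝ) : ℂ) := by
    intro v
    have hi : Integrable fun ξ => h ξ * conj (toL2 d s v ξ) :=
      mh.integrable_mul (Lp.memLp (toL2 d s v)).star
    rw [(integral_hermitianPart_mul_conj (herm v) hi).2, L2.inner_def]
    simp_rw [Complex.inner]
  have F0 : ∀ᵐ ξ, F ξ = 0 := by
    refine ae_eq_zero_of_integral_weight_test_eq_zero hs mF fun φ hφ hc => ?_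
    obtain ⟨v, hv⟩ := exists_test hs hφ hc
    have h1 := pair v
    have h0 : inner ℝ (toL2 d s v) h = 0 :=
      hh _ (Submodule.mem_map_of_mem (Submodule.subset_span ⟨φ, hφ, hc, hv⟩))
    rw [h0, mul_zero, Complex.ofReal_zero] at h1
    rw [← h1]
    refine integral_congr_ae ?_
    filter_upwards [coeFn_toL2_of_ae_eq hv (isDistribFourier_test hφ hc)] with ξ h2
    rw [h2]
  have h1 := pair u
  rw [integral_eq_zero_of_ae (by
    filter_upwards [F0] with ξ hξ
    simp [hξ])] at h1
  have h2 : 2 * inner ℝ (toL2 d s u) h = 0 := Complex.ofReal_eq_zero.1 h1.symm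
  linarith

/-- A continuous functional on `H̊ˢ` is determined by its values on test functions. -/
theorem Extends.unique [NeZero d] (hs : 0 < s) {L L' : StrongDual ℝ (HomSobolev d s)}
    {T : EuclideanSpace ℝ (Fin d) → ℝ} (hL : Extends L T) (hL' : Extends L' T) : L' = L := by
  ext u
  have hcl : IsClosed {v | L' v = L v} := isClosed_eq L'.continuous L.continuous
  refine closure_minimal (fun v hv => ?_) hcl (dense_test hs u)
  refine LinearMap.eqOn_span (f := L'.toLinearMap) (g := L.toLinearMap) ?_ hv
  rintro w ⟨φ, hφ, hc, hw⟩
  obtain ⟨w1, hw1, e1⟩ := hL φ hφ hc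
  obtain ⟨w2, hw2, e2⟩ := hL' φ hφ hc
  obtain rfl : w1 = w := ext_ae (hw1.trans hw.symm)
  obtain rfl : w2 = w1 := ext_ae (hw2.trans hw.symm)
  exact e2.trans e1.symm

end HomSobolev

end

/-! ### Absolute convergence and truncation for functions of finite energy. -/

noncomputable section

section energy

variable {d : ℕ} {s : ℝ} {T : EuclideanSpace ℝ (Fin d) → ℝ}

theorem measurable_rieszKernel_sub (α : ℝ) :
    Measurable fun p : EuclideanSpace ℝ (Fin d) × EuclideanSpace ℝ (Fin d) =>
      rieszKernel d α (p.1 - p.2) :=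
  (measurable_rieszKernel α).comp (measurable_fst.sub measurable_snd)

theorem enorm_rieszKernel_mul (hs : 0 < s) (hsd : s < (d : ℝ) / 2)
    (z : EuclideanSpace ℝ (Fin d)) (r : ℝ) :
    ‖rieszKernel d (2 * s) z * r‖ₑ =
      ENNReal.ofReal (rieszKernel d (2 * s) z) * ENNReal.ofReal |r| := by
  rw [enorm_mul, Real.enorm_eq_ofReal (rieszKernel_nonneg hs hsd z), Real.enorm_eq_ofReal_abs]

/-- The Hardy–Littlewood–Sobolev bound for `|T|`. Finiteness almost everywhere is absolute
convergence of the potential, and this potential dominates those of all truncations. -/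
theorem memLp_lrieszPotential [NeZero d] (hs : 0 < s) (hsd : s < (d : ℝ) / 2)
    (hT : Measurable T) (hE : rieszAbsEnergy (2 * s) T < ⊤) :
    (∀ᵐ x, lrieszPotential (2 * s) (fun y => ENNReal.ofReal |T y|) x < ⊤) ∧
    MemLp (fun x => (lrieszPotential (2 * s) (fun y => ENNReal.ofReal |T y|) x).toReal)
      (ENNReal.ofReal (2 * d / (d - 2 * s))) := by
  have hf : Measurable fun y => ENNReal.ofReal |T y| := by fun_prop
  have mP := measurable_lrieszPotential (2 * s) hf
  have h := lintegral_lrieszPotential_rpow_lt_top hs hsd hf hE.ne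
  have hd : 0 < (d : ℝ) := by linarith
  have hp : 0 < 2 * (d : ℝ) / (d - 2 * s) := div_pos (by linarith) (by linarith)
  have hfin : ∀ᵐ x, lrieszPotential (2 * s) (fun y => ENNReal.ofReal |T y|) x < ⊤ := by
    filter_upwards [ae_lt_top (mP.pow_const _) h.ne] with x hx
    exact (ENNReal.rpow_lt_top_iff_of_pos hp).1 hx
  refine ⟨hfin, mP.ennreal_toReal.aestronglyMeasurable, ?_⟩
  rw [eLpNorm_lt_top_iff_lintegral_rpow_enorm_lt_top (by simpa using hp) ENNReal.ofReal_ne_top,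
    ENNReal.toReal_ofReal hp.le]
  refine lt_of_eq_of_lt (lintegral_congr_ae ?_) h
  filter_upwards [hfin] with x hx
  rw [Real.enorm_eq_ofReal ENNReal.toReal_nonneg, ENNReal.ofReal_toReal hx.ne]

theorem ae_integrable_rieszKernel_mul [NeZero d] (hs : 0 < s) (hsd : s < (d : ℝ) / 2)
    (hT : Measurable T) (hE : rieszAbsEnergy (2 * s) T < ⊤) :
    ∀ᵐ x, Integrable fun y => rieszKernel d (2 * s) (x - y) * T y := by
  filter_upwards [(memLp_lrieszPotential hs hsd hT hE).1] with x hx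
  have := measurable_rieszKernel (d := d) (2 * s)
  refine ⟨Measurable.aestronglyMeasurable (by fun_prop), ?_⟩
  rw [hasFiniteIntegral_iff_enorm]
  simp_rw [enorm_rieszKernel_mul hs hsd]
  exact hx

theorem aestronglyMeasurable_rieszPotential (α : ℝ) (hT : Measurable T) :
    AEStronglyMeasurable (rieszPotential α T) := by
  have := measurable_rieszKernel_sub (d := d) α
  refine StronglyMeasurable.aestronglyMeasurable ?_
  refine StronglyMeasurable.integral_prod_right (f := fun x y => rieszKernel d α (x - y) * T y) ?_
  exact Measurable.stronglyMeasurable (this.mul (hT.comp measurable_snd))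

theorem enorm_rieszPotential_le (hs : 0 < s) (hsd : s < (d : ℝ) / 2)
    {S : EuclideanSpace ℝ (Fin d) → ℝ} (hST : ∀ x, |S x| ≤ |T x|) (x : EuclideanSpace ℝ (Fin d)) :
    ‖rieszPotential (2 * s) S x‖ₑ ≤
      lrieszPotential (2 * s) (fun y => ENNReal.ofReal |T y|) x := by
  refine (enorm_integral_le_lintegral_enorm _).trans (lintegral_mono fun y => ?_)
  rw [enorm_rieszKernel_mul hs hsd]
  exact mul_le_mul_right (ENNReal.ofReal_le_ofReal (hST y)) _

/-- The exceptional null set depends on `T` alone, so a single one serves every `S` below `|T|`. -/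
theorem ae_norm_rieszPotential_le [NeZero d] (hs : 0 < s) (hsd : s < (d : ℝ) / 2)
    (hT : Measurable T) (hE : rieszAbsEnergy (2 * s) T < ⊤) :
    ∀ᵐ x, ∀ S : EuclideanSpace ℝ (Fin d) → ℝ, (∀ x, |S x| ≤ |T x|) →
      ‖rieszPotential (2 * s) S x‖ ≤
        (lrieszPotential (2 * s) (fun y => ENNReal.ofReal |T y|) x).toReal := by
  filter_upwards [(memLp_lrieszPotential hs hsd hT hE).1] with x hx S hS
  rw [← toReal_enorm]
  exact ENNReal.toReal_mono hx.ne (enorm_rieszPotential_le hs hsd hS x)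

theorem memLp_rieszPotential [NeZero d] (hs : 0 < s) (hsd : s < (d : ℝ) / 2)
    (hT : Measurable T) (hE : rieszAbsEnergy (2 * s) T < ⊤) :
    MemLp (rieszPotential (2 * s) T) (ENNReal.ofReal (2 * d / (d - 2 * s))) := by
  refine (memLp_lrieszPotential hs hsd hT hE).2.mono
    (aestronglyMeasurable_rieszPotential _ hT) ?_
  filter_upwards [ae_norm_rieszPotential_le hs hsd hT hE] with x hx
  exact (hx T fun _ => le_rfl).trans (le_abs_self _)

/-- Hölder with the conjugate exponent; this is the majorant in the later dominated convergence. -/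
theorem integrable_lrieszPotential_mul_schwartz [NeZero d] (hs : 0 < s) (hsd : s < (d : ℝ) / 2)
    (hT : Measurable T) (hE : rieszAbsEnergy (2 * s) T < ⊤)
    (φ : 𝓢(EuclideanSpace ℝ (Fin d), ℂ)) :
    Integrable fun x => (lrieszPotential (2 * s) (fun y => ENNReal.ofReal |T y|) x).toReal *
      ‖φ x‖ := by
  set p := ENNReal.ofReal (2 * d / (d - 2 * s)) with hp
  have h1 : 1 ≤ p := HomSobolev.one_le_exponent hs hsd
  have := ENNReal.HolderConjugate.conjExponent h1
  exact (memLp_lrieszPotential hs hsd hT hE).2.integrable_mul (q := p.conjExponent)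
    (φ.memLp p.conjExponent).norm

/-- By Tonelli, `rieszAbsEnergy` is the integral of the norm of this function. -/
theorem integrable_rieszKernel_energy (hs : 0 < s) (hsd : s < (d : ℝ) / 2)
    (hT : Measurable T) (hE : rieszAbsEnergy (2 * s) T < ⊤) :
    Integrable fun p : EuclideanSpace ℝ (Fin d) × EuclideanSpace ℝ (Fin d) =>
      rieszKernel d (2 * s) (p.1 - p.2) * (T p.1 * T p.2) := by
  have mk := measurable_rieszKernel_sub (d := d) (2 * s)
  have m : Measurable fun p : EuclideanSpace ℝ (Fin d) × EuclideanSpace ℝ (Fin d) =>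
      rieszKernel d (2 * s) (p.1 - p.2) * (T p.1 * T p.2) := by fun_prop
  refine ⟨m.aestronglyMeasurable, ?_⟩
  rw [hasFiniteIntegral_iff_enorm, Measure.volume_eq_prod, lintegral_prod _ m.enorm.aemeasurable]
  refine lt_of_eq_of_lt (lintegral_congr fun x => ?_) hE
  rw [← lintegral_mul_const]
  · refine lintegral_congr fun y => ?_
    simp only [enorm_rieszKernel_mul hs hsd]
    rw [abs_mul, ENNReal.ofReal_mul (abs_nonneg _)]
    ring
  · have := measurable_rieszKernel (d := d) (2 * s)
    fun_prop

theorem integrable_rieszPotential_mul (hs : 0 < s) (hsd : s < (d : ℝ) / 2)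
    (hT : Measurable T) (hE : rieszAbsEnergy (2 * s) T < ⊤) :
    Integrable (fun x => rieszPotential (2 * s) T x * T x) ∧
    rieszEnergy (2 * s) T =
      ∫ p : EuclideanSpace ℝ (Fin d) × EuclideanSpace ℝ (Fin d),
        rieszKernel d (2 * s) (p.1 - p.2) * (T p.1 * T p.2) := by
  have hi := integrable_rieszKernel_energy hs hsd hT hE
  rw [Measure.volume_eq_prod] at hi
  have e : ∀ x, ∫ y, rieszKernel d (2 * s) (x - y) * (T x * T y) =
      rieszPotential (2 * s) T x * T x := by
    intro x
    rw [rieszPotential, ← integral_mul_const]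
    congr 1
    ext y
    ring
  constructor
  · refine hi.integral_prod_left.congr (Eventually.of_forall fun x => ?_)
    exact e x
  · rw [Measure.volume_eq_prod, integral_prod _ hi, rieszEnergy]
    simp_rw [e]

/-- The Fourier transform of the Riesz potential of an integrable function. -/
theorem integral_rieszPotential_mul_fourier [NeZero d] (hs : 0 < s) (hsd : s < (d : ℝ) / 2)
    (hT : Measurable T) (hE : rieszAbsEnergy (2 * s) T < ⊤)
    {S : EuclideanSpace ℝ (Fin d) → ℝ} (hS : Measurable S) (hST : ∀ x, |S x| ≤ |T x|)
    (hSi : Integrable S) (φ : 𝓢(EuclideanSpace ℝ (Fin d), ℂ)) :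
    ∫ ξ, (((2 * Real.pi * ‖ξ‖) ^ (-(2 * s)) : ℝ) : ℂ) * 𝓕 (fun x => (S x : ℂ)) ξ * φ ξ =
      ∫ x, (rieszPotential (2 * s) S x : ℂ) * (𝓕 φ : 𝓢(EuclideanSpace ℝ (Fin d), ℂ)) x := by
  have mk := measurable_rieszKernel_sub (d := d) (2 * s)
  have iS : Integrable fun x => (S x : ℂ) := hSi.ofReal
  set Φ : 𝓢(EuclideanSpace ℝ (Fin d), ℂ) := 𝓕 φ with hΦ
  have hI : Integrable fun p : EuclideanSpace ℝ (Fin d) × EuclideanSpace ℝ (Fin d) =>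
      (rieszKernel d (2 * s) (p.1 - p.2) : ℂ) * (Φ p.1 * (S p.2 : ℂ)) := by
    have mΦ : Measurable Φ := Φ.continuous.measurable
    have m : Measurable fun p : EuclideanSpace ℝ (Fin d) × EuclideanSpace ℝ (Fin d) =>
      (rieszKernel d (2 * s) (p.1 - p.2) : ℂ) * (Φ p.1 * (S p.2 : ℂ)) := by fun_prop
    refine ⟨m.aestronglyMeasurable, ?_⟩
    rw [hasFiniteIntegral_iff_enorm, Measure.volume_eq_prod, lintegral_prod _ m.enorm.aemeasurable]
    refine lt_of_le_of_lt (lintegral_mono_ae ?_)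
      (integrable_lrieszPotential_mul_schwartz hs hsd hT hE Φ).lintegral_lt_top
    filter_upwards [(memLp_lrieszPotential hs hsd hT hE).1] with x hx
    have mr := measurable_rieszKernel (d := d) (2 * s)
    rw [ENNReal.ofReal_mul ENNReal.toReal_nonneg, ENNReal.ofReal_toReal hx.ne, lrieszPotential,
      ← lintegral_mul_const _ (by fun_prop)]
    refine lintegral_mono fun y => ?_
    rw [enorm_mul, enorm_mul, ofReal_norm, mul_assoc, mul_comm (ENNReal.ofReal |T y|),
      ← ofReal_norm (rieszKernel d (2 * s) (x - y) : ℂ), Complex.norm_real,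
      Real.norm_of_nonneg (rieszKernel_nonneg hs hsd _),
      ← ofReal_norm (S y : ℂ), Complex.norm_real, Real.norm_eq_abs]
    exact mul_le_mul_right (mul_le_mul_right (ENNReal.ofReal_le_ofReal (hST y)) _) _
  -- Parseval is applied to `Φ = 𝓕 φ` and `S`, so a double transform appears, which is a reflection.
  have eΦ : ∀ ξ, 𝓕 (Φ : EuclideanSpace ℝ (Fin d) → ℂ) ξ = φ (-ξ) := by
    intro ξ
    have h1 : 𝓕⁻ Φ = φ := FourierTransform.fourierInv_fourier_eq _
    rw [← h1, SchwartzMap.fourierInv_coe, Real.fourierInv_eq_fourier_neg, neg_neg]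
  -- The transform of `S` is bounded, and `2s < d` makes the weight integrable against a Schwartz
  -- function.
  have hW : Integrable fun ξ => (((2 * Real.pi * ‖ξ‖) ^ (-(2 * s)) : ℝ) : ℂ) *
      (𝓕 (Φ : EuclideanSpace ℝ (Fin d) → ℂ) ξ * 𝓕 (fun x => (S x : ℂ)) (-ξ)) := by
    have i1 := ((integrable_norm_rpow_mul_schwartz (a := -(2 * s)) (by linarith) φ).comp_neg).mul_const
      (∫ x, ‖(S x : ℂ)‖)
    refine i1.mono' ?_ (Eventually.of_forall fun ξ => ?_)
    · refine AEStronglyMeasurable.mul (Measurable.aestronglyMeasurable (by fun_prop)) ?_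
      exact ((continuous_fourier_of_integrable Φ.integrable).mul
        ((continuous_fourier_of_integrable iS).comp continuous_neg)).aestronglyMeasurable
    · rw [eΦ, norm_mul, norm_mul, Complex.norm_real, Real.norm_of_nonneg (by positivity), norm_neg,
        ← mul_assoc]
      exact mul_le_mul_of_nonneg_left (norm_fourier_le _ _) (by positivity)
  have h := integral_rieszKernel_mul_mul hs hsd Φ.integrable iS hI hW
  rw [Measure.volume_eq_prod] at hI h
  rw [integral_prod _ hI] at h
  have e1 : ∀ x, ∫ y, (rieszKernel d (2 * s) (x - y) : ℂ) * (Φ x * (S y : ℂ)) =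
      (rieszPotential (2 * s) S x : ℂ) * Φ x := by
    intro x
    rw [rieszPotential, ← integral_complex_ofReal, ← integral_mul_const]
    congr 1
    ext y
    push_cast
    ring
  simp_rw [e1] at h
  rw [h, ← integral_neg_eq_self]
  congr 1
  ext ξ
  rw [eΦ, norm_neg]
  ring

/-- The restriction of `T` to the ball of radius `n`. -/
def truncate (T : EuclideanSpace ℝ (Fin d) → ℝ) (n : ℕ) : EuclideanSpace ℝ (Fin d) → ℝ :=
  (Metric.ball 0 n).indicator T

theorem measurable_truncate (hT : Measurable T) (n : ℕ) : Measurable (truncate T n) :=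
  hT.indicator measurableSet_ball

theorem abs_truncate_le (T : EuclideanSpace ℝ (Fin d) → ℝ) (n : ℕ)
    (x : EuclideanSpace ℝ (Fin d)) : |truncate T n x| ≤ |T x| :=
  norm_indicator_le_norm_self T x

theorem integrable_truncate (hT : LocallyIntegrable T) (n : ℕ) : Integrable (truncate T n) :=
  (integrable_indicator_iff measurableSet_ball).2
    ((hT.integrableOn_isCompact (isCompact_closedBall 0 (n : ℝ))).mono_set
      Metric.ball_subset_closedBall)

theorem tendsto_truncate (T : EuclideanSpace ℝ (Fin d) → ℝ) (x : EuclideanSpace ℝ (Fin d)) :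
    Tendsto (fun n => truncate T n x) atTop (nhds (T x)) := by
  obtain ⟨N, hN⟩ := exists_nat_gt ‖x‖
  refine tendsto_const_nhds.congr' ?_
  filter_upwards [eventually_ge_atTop N] with n hn
  rw [truncate, indicator_of_mem]
  have : (N : ℝ) ≤ n := by exact_mod_cast hn
  simpa using hN.trans_le this

theorem rieszAbsEnergy_mono {S : EuclideanSpace ℝ (Fin d) → ℝ} (α : ℝ)
    (hST : ∀ x, |S x| ≤ |T x|) : rieszAbsEnergy α S ≤ rieszAbsEnergy α T := by
  unfold rieszAbsEnergy
  refine lintegral_mono fun x => mul_le_mul' (lintegral_mono fun y => ?_) ?_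
  · exact mul_le_mul_right (ENNReal.ofReal_le_ofReal (hST y)) _
  · exact ENNReal.ofReal_le_ofReal (hST x)

/-- `|ξ|^(-s) f̂` belongs to `L²` for integrable functions of finite energy. -/
theorem memLp_weight_mul_fourier_of_energy [NeZero d] (hs : 0 < s) (hsd : s < (d : ℝ) / 2)
    {S : EuclideanSpace ℝ (Fin d) → ℝ} (hS : Measurable S) (hE : rieszAbsEnergy (2 * s) S < ⊤)
    (hSi : Integrable S) :
    ∃ h : MemLp (fun ξ => (((2 * Real.pi * ‖ξ‖) ^ (-s) : ℝ) : ℂ) * 𝓕 (fun x => (S x : ℂ)) ξ) 2,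
      ‖h.toLp _‖ ^ 2 = ∫ p : EuclideanSpace ℝ (Fin d) × EuclideanSpace ℝ (Fin d),
        rieszKernel d (2 * s) (p.1 - p.2) * (S p.1 * S p.2) := by
  obtain ⟨h1, h2⟩ := integrable_weight_mul_normSq_fourier hs hsd hSi
    (integrable_rieszKernel_energy hs hsd hS hE)
  have iS : Integrable fun x => (S x : ℂ) := hSi.ofReal
  have hc := (continuous_fourier_of_integrable iS).aestronglyMeasurable (μ := volume)
  have h := (memLp_two_weight_mul_iff (a := -s) hc).2 (by simpa only [mul_neg] using h1)
  refine ⟨h, ?_⟩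
  rw [h2, ← real_inner_self_eq_norm_sq, L2.inner_def]
  refine integral_congr_ae ?_
  filter_upwards [h.coeFn_toLp] with ξ hξ
  rw [hξ, real_inner_self_eq_norm_sq, norm_weight_mul_sq, mul_neg]

end energy
end

/-! ### Passage to the limit in the truncations. -/

noncomputable section

section limit

variable {d : ℕ} {s : ℝ} {T : EuclideanSpace ℝ (Fin d) → ℝ}

theorem tendsto_integral_truncate_energy (hs : 0 < s) (hsd : s < (d : ℝ) / 2)
    (hT : Measurable T) (hE : rieszAbsEnergy (2 * s) T < ⊤) :
    Tendsto (fun n => ∫ p : EuclideanSpace ℝ (Fin d) × EuclideanSpace ℝ (Fin d),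
      rieszKernel d (2 * s) (p.1 - p.2) * (truncate T n p.1 * truncate T n p.2)) atTop
      (nhds (rieszEnergy (2 * s) T)) := by
  rw [(integrable_rieszPotential_mul hs hsd hT hE).2]
  have mk := measurable_rieszKernel_sub (d := d) (2 * s)
  refine tendsto_integral_of_dominated_convergence _ (fun n => ?_)
    (integrable_rieszKernel_energy hs hsd hT hE).norm (fun n => Eventually.of_forall fun p => ?_)
    (Eventually.of_forall fun p => ?_)
  · have := measurable_truncate hT n
    exact Measurable.aestronglyMeasurable (by fun_prop)
  · rw [norm_mul, norm_mul, norm_mul, norm_mul]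
    exact mul_le_mul_of_nonneg_left (mul_le_mul (abs_truncate_le T n _) (abs_truncate_le T n _)
      (norm_nonneg _) (norm_nonneg _)) (norm_nonneg _)
  · exact ((tendsto_truncate T p.1).mul (tendsto_truncate T p.2)).const_mul _

theorem abs_truncate_sub_truncate_le (T : EuclideanSpace ℝ (Fin d) → ℝ) {N n m : ℕ} (hn : N ≤ n)
    (hm : N ≤ m) (x : EuclideanSpace ℝ (Fin d)) :
    |truncate T n x - truncate T m x| ≤ (Metric.ball 0 N)ᶜ.indicator (fun x => |T x|) x := by
  have hn' : (N : ℝ) ≤ n := by exact_mod_cast hn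
  have hm' : (N : ℝ) ≤ m := by exact_mod_cast hm
  unfold truncate
  by_cases hx : x ∈ Metric.ball (0 : EuclideanSpace ℝ (Fin d)) N
  · rw [indicator_of_mem (Metric.ball_subset_ball hn' hx),
      indicator_of_mem (Metric.ball_subset_ball hm' hx), sub_self, abs_zero]
    exact indicator_nonneg (fun _ _ => abs_nonneg _) _
  · rw [indicator_of_mem (show x ∈ (Metric.ball (0 : EuclideanSpace ℝ (Fin d)) N)ᶜ from hx)]
    simp only [indicator]
    split_ifs <;> simp

/-- The energies of differences of truncations tend to zero. -/
theorem exists_truncate_energy_bound (hs : 0 < s) (hsd : s < (d : ℝ) / 2)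
    (hT : Measurable T) (hE : rieszAbsEnergy (2 * s) T < ⊤) :
    ∃ b : ℕ → ℝ, Tendsto b atTop (nhds 0) ∧ ∀ N n m, N ≤ n → N ≤ m →
      ∫ p : EuclideanSpace ℝ (Fin d) × EuclideanSpace ℝ (Fin d),
        rieszKernel d (2 * s) (p.1 - p.2) * ((truncate T n p.1 - truncate T m p.1) *
          (truncate T n p.2 - truncate T m p.2)) ≤ b N := by
  have mk := measurable_rieszKernel_sub (d := d) (2 * s)
  have hK := integrable_rieszKernel_energy hs hsd hT hE
  set A : ℕ → Set (EuclideanSpace ℝ (Fin d) × EuclideanSpace ℝ (Fin d)) := fun N =>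
    Prod.fst ⁻¹' (Metric.ball 0 N)ᶜ with hA
  have mA : ∀ N, MeasurableSet (A N) := fun N => measurable_fst measurableSet_ball.compl
  -- The bound is the part of the absolute energy with first variable outside the ball of radius
  -- `N`. Cutting one variable suffices, because the difference of truncations vanishes inside that
  -- ball.
  refine ⟨fun N => ∫ p, (A N).indicator (fun p =>
    ‖rieszKernel d (2 * s) (p.1 - p.2) * (T p.1 * T p.2)‖) p, ?_, fun N n m hn hm => ?_⟩
  · rw [← integral_zero (EuclideanSpace ℝ (Fin d) × EuclideanSpace ℝ (Fin d)) ℝ]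
    refine tendsto_integral_of_dominated_convergence _ (fun N => ?_) hK.norm
      (fun N => Eventually.of_forall fun p => ?_) (Eventually.of_forall fun p => ?_)
    · exact hK.norm.aestronglyMeasurable.indicator (mA N)
    · rw [norm_indicator_eq_indicator_norm]
      refine (indicator_le_self' (fun _ _ => norm_nonneg _) p).trans ?_
      rw [norm_norm]
    · obtain ⟨M, hM⟩ := exists_nat_gt ‖p.1‖
      refine tendsto_const_nhds.congr' ?_
      filter_upwards [eventually_ge_atTop M] with N hN
      rw [indicator_of_notMem]
      have : (M : ℝ) ≤ N := by exact_mod_cast hN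
      simpa [hA] using hM.trans_le this
  · refine (Real.le_norm_self _).trans (norm_integral_le_of_norm_le (hK.norm.indicator (mA N))
      (Eventually.of_forall fun p => ?_))
    have h1 := abs_truncate_sub_truncate_le T hn hm p.1
    have h2 : |truncate T n p.2 - truncate T m p.2| ≤ |T p.2| :=
      (abs_truncate_sub_truncate_le T hn hm p.2).trans
        (indicator_le_self' (fun _ _ => abs_nonneg _) _)
    simp only [norm_mul, Real.norm_eq_abs]
    by_cases hp : p.1 ∈ Metric.ball (0 : EuclideanSpace ℝ (Fin d)) N
    · rw [indicator_of_notMem (by simpa using hp)] at h1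
      have h3 : |truncate T n p.1 - truncate T m p.1| = 0 := le_antisymm h1 (abs_nonneg _)
      rw [h3, zero_mul, mul_zero]
      exact indicator_nonneg (fun _ _ => by positivity) _
    · rw [indicator_of_mem (show p.1 ∈ (Metric.ball (0 : EuclideanSpace ℝ (Fin d)) N)ᶜ from hp)] at h1
      rw [indicator_of_mem (show p ∈ A N from hp)]
      gcongr

/-- The bilinear pairing with `k` is the inner product with `conj k`, hence continuous. -/
theorem tendsto_integral_mul_of_tendsto_Lp {α : Type*} [MeasurableSpace α] {μ : Measure α}
    {H : ℕ → Lp ℂ 2 μ} {h : Lp ℂ 2 μ} (hH : Tendsto H atTop (nhds h)) {k : α → ℂ}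
    (hk : MemLp k 2 μ) :
    Tendsto (fun n => ∫ x, H n x * k x ∂μ) atTop (nhds (∫ x, h x * k x ∂μ)) := by
  have e : ∀ f : Lp ℂ 2 μ, inner ℂ (hk.star.toLp _) f = ∫ x, f x * k x ∂μ := by
    intro f
    rw [L2.inner_def]
    refine integral_congr_ae ?_
    filter_upwards [hk.star.coeFn_toLp] with x hx
    rw [hx, RCLike.inner_apply]
    simp
  simp_rw [← e]
  exact tendsto_const_nhds.inner hH

theorem fourier_sub_of_integrable {f g : EuclideanSpace ℝ (Fin d) → ℂ} (hf : Integrable f)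
    (hg : Integrable g) (ξ : EuclideanSpace ℝ (Fin d)) :
    𝓕 (fun x => f x - g x) ξ = 𝓕 f ξ - 𝓕 g ξ := by
  rw [Real.fourier_eq, Real.fourier_eq, Real.fourier_eq, ← integral_sub]
  · simp_rw [smul_sub]
  · exact (Real.fourierIntegral_convergent_iff ξ).2 hf
  · exact (Real.fourierIntegral_convergent_iff ξ).2 hg

/-- The functions `|ξ|^(-s) T̂ₙ`, with `Tₙ` the truncations of `T`, converge in `L²`. -/
theorem exists_limit_weight_mul_fourier [NeZero d] (hs : 0 < s) (hsd : s < (d : ℝ) / 2)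
    (hT : Measurable T) (hTl : LocallyIntegrable T) (hE : rieszAbsEnergy (2 * s) T < ⊤) :
    ∃ h : Lp (α := EuclideanSpace ℝ (Fin d)) ℂ 2 volume, ‖h‖ ^ 2 = rieszEnergy (2 * s) T ∧
      ∀ k : EuclideanSpace ℝ (Fin d) → ℂ, MemLp k 2 →
        Tendsto (fun n => ∫ ξ, ((((2 * Real.pi * ‖ξ‖) ^ (-s) : ℝ) : ℂ) *
          𝓕 (fun x => (truncate T n x : ℂ)) ξ) * k ξ) atTop (nhds (∫ ξ, h ξ * k ξ)) := by
  have hEn : ∀ n, rieszAbsEnergy (2 * s) (truncate T n) < ⊤ := fun n =>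
    (rieszAbsEnergy_mono _ (abs_truncate_le T n)).trans_lt hE
  choose hmem hnorm using fun n => memLp_weight_mul_fourier_of_energy hs hsd
    (measurable_truncate hT n) (hEn n) (integrable_truncate hTl n)
  have iC : ∀ n, Integrable fun x => (truncate T n x : ℂ) := fun n =>
    (integrable_truncate hTl n).ofReal
  set H := fun n => (hmem n).toLp _ with hH
  obtain ⟨b, hb0, hb⟩ := exists_truncate_energy_bound hs hsd hT hE
  have hdist : ∀ n m, ‖H n - H m‖ ^ 2 =
      ∫ p : EuclideanSpace ℝ (Fin d) × EuclideanSpace ℝ (Fin d),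
        rieszKernel d (2 * s) (p.1 - p.2) * ((truncate T n p.1 - truncate T m p.1) *
          (truncate T n p.2 - truncate T m p.2)) := by
    intro n m
    have hle : ∀ x, |truncate T n x - truncate T m x| ≤ |T x| := fun x =>
      (abs_truncate_sub_truncate_le T (Nat.zero_le n) (Nat.zero_le m) x).trans
        (indicator_le_self' (fun _ _ => abs_nonneg _) _)
    obtain ⟨h1, h2⟩ := memLp_weight_mul_fourier_of_energy hs hsd
      (S := fun x => truncate T n x - truncate T m x) ((measurable_truncate hT n).sub (measurable_truncate hT m))
      ((rieszAbsEnergy_mono (2 * s) hle).trans_lt hE)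
      ((integrable_truncate hTl n).sub (integrable_truncate hTl m))
    rw [← h2]
    congr 2
    refine Lp.ext ?_
    filter_upwards [h1.coeFn_toLp, (hmem n).coeFn_toLp, (hmem m).coeFn_toLp,
      Lp.coeFn_sub (H n) (H m)] with ξ e1 e2 e3 e4
    rw [e4, e1, Pi.sub_apply, e2, e3, ← mul_sub, ← fourier_sub_of_integrable (iC n) (iC m)]
    simp only [Complex.ofReal_sub]
  -- By `hdist`, which is Parseval for `Tₙ - Tₘ`, the squared distances are energies of differences,
  -- and these are at most `b N`.
  have hc : CauchySeq H := by
    refine cauchySeq_of_le_tendsto_0 (fun N => Real.sqrt (b N)) (fun n m N hn hm => ?_) ?_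
    · rw [dist_eq_norm]
      refine Real.le_sqrt_of_sq_le ?_
      rw [hdist]
      exact hb N n m hn hm
    · simpa using hb0.sqrt
  obtain ⟨h, hh⟩ := cauchySeq_tendsto_of_complete hc
  refine ⟨h, ?_, fun k hk => ?_⟩
  · refine tendsto_nhds_unique (hh.norm.pow 2) ?_
    simp_rw [hH, hnorm]
    exact tendsto_integral_truncate_energy hs hsd hT hE
  · refine (tendsto_integral_mul_of_tendsto_Lp hh hk).congr fun n => ?_
    refine integral_congr_ae ?_
    filter_upwards [(hmem n).coeFn_toLp] with ξ hξ
    rw [hξ]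

/-- Test with a bump function equal to `1` near the given point. -/
theorem locallyIntegrable_of_integrable_mul_schwartz {g : EuclideanSpace ℝ (Fin d) → ℂ}
    (hg : ∀ φ : 𝓢(EuclideanSpace ℝ (Fin d), ℂ), Integrable fun ξ => g ξ * φ ξ) :
    LocallyIntegrable g := by
  intro x
  let b : ContDiffBump x := ⟨1, 2, one_pos, one_lt_two⟩
  refine ⟨Metric.closedBall x 1, Metric.closedBall_mem_nhds x one_pos, ?_⟩
  refine (hg (testToSchwartz b.contDiff b.hasCompactSupport)).integrableOn.congr_fun
    (fun ξ hξ => ?_) measurableSet_closedBall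
  simp [b.one_of_mem_closedBall hξ]

/-- The distributional Fourier transform of a Riesz potential of finite energy. -/
theorem isDistribFourier_rieszPotential [NeZero d] (hs : 0 < s) (hsd : s < (d : ℝ) / 2)
    (hT : Measurable T) (hTl : LocallyIntegrable T) (hE : rieszAbsEnergy (2 * s) T < ⊤)
    {h : Lp (α := EuclideanSpace ℝ (Fin d)) ℂ 2 volume}
    (hh : ∀ k : EuclideanSpace ℝ (Fin d) → ℂ, MemLp k 2 →
        Tendsto (fun n => ∫ ξ, ((((2 * Real.pi * ‖ξ‖) ^ (-s) : ℝ) : ℂ) *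
          𝓕 (fun x => (truncate T n x : ℂ)) ξ) * k ξ) atTop (nhds (∫ ξ, h ξ * k ξ))) :
    IsDistribFourier (rieszPotential (2 * s) T)
      (fun ξ => (((2 * Real.pi * ‖ξ‖) ^ (-s) : ℝ) : ℂ) * h ξ) := by
  have mk : ∀ φ : 𝓢(EuclideanSpace ℝ (Fin d), ℂ),
      MemLp (fun ξ => (((2 * Real.pi * ‖ξ‖) ^ (-s) : ℝ) : ℂ) * φ ξ) 2 := fun φ =>
    memLp_two_weight_mul_schwartz (by linarith) φ
  have e : ∀ (φ : 𝓢(EuclideanSpace ℝ (Fin d), ℂ)) ξ,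
      h ξ * ((((2 * Real.pi * ‖ξ‖) ^ (-s) : ℝ) : ℂ) * φ ξ) =
      (((2 * Real.pi * ‖ξ‖) ^ (-s) : ℝ) : ℂ) * h ξ * φ ξ := fun φ ξ => by ring
  have i1 : ∀ φ : 𝓢(EuclideanSpace ℝ (Fin d), ℂ),
      Integrable fun ξ => (((2 * Real.pi * ‖ξ‖) ^ (-s) : ℝ) : ℂ) * h ξ * φ ξ := fun φ =>
    ((Lp.memLp h).integrable_mul (mk φ)).congr (Eventually.of_forall (e φ))
  refine ⟨locallyIntegrable_of_integrable_mul_schwartz i1, fun φ => ?_⟩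
  set Φ : 𝓢(EuclideanSpace ℝ (Fin d), ℂ) := 𝓕 φ with hΦ
  have iP := integrable_lrieszPotential_mul_schwartz hs hsd hT hE Φ
  have bd := ae_norm_rieszPotential_le hs hsd hT hE
  have m : ∀ {S : EuclideanSpace ℝ (Fin d) → ℝ}, Measurable S →
      AEStronglyMeasurable (fun x => (rieszPotential (2 * s) S x : ℂ) * Φ x) volume := fun hS =>
    (Complex.continuous_ofReal.comp_aestronglyMeasurable
      (aestronglyMeasurable_rieszPotential _ hS)).mul Φ.continuous.aestronglyMeasurable
  have hbd : ∀ᵐ x, ∀ S : EuclideanSpace ℝ (Fin d) → ℝ, (∀ x, |S x| ≤ |T x|) →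
      ‖(rieszPotential (2 * s) S x : ℂ) * Φ x‖ ≤
        (lrieszPotential (2 * s) (fun y => ENNReal.ofReal |T y|) x).toReal * ‖Φ x‖ := by
    filter_upwards [bd] with x hx S hS
    rw [norm_mul, Complex.norm_real]
    exact mul_le_mul_of_nonneg_right (hx S hS) (norm_nonneg _)
  refine ⟨iP.mono' (m hT) ?_, i1 φ, ?_⟩
  · filter_upwards [hbd] with x hx using hx T fun _ => le_rfl
  · simp_rw [← e]
    -- The identity is known for the integrable truncations. The Fourier side converges by the `L²`
    -- limit, the other side by dominated convergence, once in `x` and once inside the potential.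
    refine tendsto_nhds_unique (hh _ (mk φ)) ?_
    have e2 : ∀ n, ∫ ξ, ((((2 * Real.pi * ‖ξ‖) ^ (-s) : ℝ) : ℂ) *
        𝓕 (fun x => (truncate T n x : ℂ)) ξ) * ((((2 * Real.pi * ‖ξ‖) ^ (-s) : ℝ) : ℂ) * φ ξ) =
        ∫ x, (rieszPotential (2 * s) (truncate T n) x : ℂ) * Φ x := by
      intro n
      rw [← integral_rieszPotential_mul_fourier hs hsd hT hE (measurable_truncate hT n)
        (abs_truncate_le T n) (integrable_truncate hTl n) φ]
      refine integral_congr_ae ?_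
      filter_upwards [ae_ne_zero] with ξ hξ
      have h0 : 0 < ‖ξ‖ := norm_pos_iff.2 hξ
      rw [show -(2 * s) = -s + -s by ring, Real.rpow_add (by positivity)]
      push_cast
      ring
    simp_rw [e2]
    refine tendsto_integral_of_dominated_convergence _ (fun n => m (measurable_truncate hT n)) iP
      (fun n => ?_) ?_
    · filter_upwards [hbd] with x hx using hx _ (abs_truncate_le T n)
    · filter_upwards [ae_integrable_rieszKernel_mul hs hsd hT hE] with x hx
      refine Tendsto.mul_const _ ((Complex.continuous_ofReal.tendsto _).comp ?_)
      unfold rieszPotential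
      have mr := measurable_rieszKernel (d := d) (2 * s)
      refine tendsto_integral_of_dominated_convergence _ (fun n => ?_) hx.norm
        (fun n => Eventually.of_forall fun y => ?_) (Eventually.of_forall fun y => ?_)
      · have := measurable_truncate hT n
        exact Measurable.aestronglyMeasurable (by fun_prop)
      · rw [norm_mul, norm_mul]
        exact mul_le_mul_of_nonneg_left (abs_truncate_le T n y) (norm_nonneg _)
      · exact (tendsto_truncate T y).const_mul _

/-- Parseval's identity between an integrable real function and a real test function. -/
theorem integral_fourier_mul_conj_fourier_test {S φ : EuclideanSpace ℝ (Fin d) → ℝ}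
    (hS : Integrable S) (hφ : ContDiff ℝ ∞ φ) (hc : HasCompactSupport φ) :
    ∫ ξ, 𝓕 (fun x => (S x : ℂ)) ξ *
      conj ((𝓕 (testToSchwartz hφ hc) : 𝓢(EuclideanSpace ℝ (Fin d), ℂ)) ξ) =
    ((∫ x, S x * φ x : ℝ) : ℂ) := by
  set Φ := testToSchwartz hφ hc with hΦ
  have iS : Integrable fun x => (S x : ℂ) := hS.ofReal
  have e1 : ∀ ξ, conj ((𝓕 Φ : 𝓢(EuclideanSpace ℝ (Fin d), ℂ)) ξ) = (𝓕⁻ Φ) ξ := by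
    intro ξ
    rw [SchwartzMap.fourierInv_coe, Real.fourierInv_eq_fourier_neg, SchwartzMap.fourier_coe]
    exact (fourier_ofReal_neg φ ξ).symm
  simp_rw [e1]
  rw [integral_fourier_mul_eq_of_integrable iS (𝓕⁻ Φ).integrable, ← SchwartzMap.fourier_coe,
    FourierTransform.fourier_fourierInv_eq, ← integral_complex_ofReal]
  simp [hΦ]

/-- The Riesz potential of a function of finite energy, as an element of `H̊ˢ`. -/
theorem exists_homSobolev_rieszPotential [NeZero d] (hs : 0 < s) (hsd : s < (d : ℝ) / 2)
    (hT : Measurable T) (hTl : LocallyIntegrable T) (hE : rieszAbsEnergy (2 * s) T < ⊤) :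
    ∃ U : HomSobolev d s, U =ᵐ[volume] rieszPotential (2 * s) T ∧
      ‖U‖ ^ 2 = rieszEnergy (2 * s) T ∧
      ∀ φ : EuclideanSpace ℝ (Fin d) → ℝ, ContDiff ℝ ∞ φ → HasCompactSupport φ →
        ∀ v : HomSobolev d s, v =ᵐ[volume] φ → inner ℝ U v = ∫ x, T x * φ x := by
  obtain ⟨h, hnorm, hh⟩ := exists_limit_weight_mul_fourier hs hsd hT hTl hE
  have hF := isDistribFourier_rieszPotential hs hsd hT hTl hE hh
  have hae : (fun ξ => (((2 * Real.pi * ‖ξ‖) ^ s : ℝ) : ℂ) *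
      ((((2 * Real.pi * ‖ξ‖) ^ (-s) : ℝ) : ℂ) * h ξ)) =ᵐ[volume] h := by
    filter_upwards [ae_ne_zero] with ξ hξ
    rw [← mul_assoc, ← Complex.ofReal_mul, mul_comm ((2 * Real.pi * ‖ξ‖) ^ s),
      weight_neg_mul_weight s hξ, Complex.ofReal_one, one_mul]
  have hfin : HasFiniteHomNorm s (rieszPotential (2 * s) T) :=
    ⟨_, hF, (memLp_two_weight_mul_iff hF.1.aestronglyMeasurable).1
      ((memLp_congr_ae hae).2 (Lp.memLp h))⟩
  set U := HomSobolev.ofMemLp (memLp_rieszPotential hs hsd hT hE) hfin with hU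
  have hUae : U =ᵐ[volume] rieszPotential (2 * s) T := HomSobolev.coeFn_ofMemLp _ _
  have hJ : HomSobolev.toL2 d s U = h :=
    Lp.ext ((HomSobolev.coeFn_toL2_of_ae_eq hUae hF).trans hae)
  refine ⟨U, hUae, ?_, fun φ hφ hc v hv => ?_⟩
  · rw [← (HomSobolev.toL2 d s).norm_map, hJ, hnorm]
  · set Φ := testToSchwartz hφ hc with hΦ
    have hd : 0 ≤ (d : ℝ) := Nat.cast_nonneg d
    have mk := (memLp_two_weight_mul_schwartz (a := s) (by linarith) (𝓕 Φ)).star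
    have hJv := HomSobolev.coeFn_toL2_of_ae_eq hv (isDistribFourier_test hφ hc)
    have hi : Integrable fun ξ => h ξ * conj ((((2 * Real.pi * ‖ξ‖) ^ s : ℝ) : ℂ) *
        (𝓕 Φ : 𝓢(EuclideanSpace ℝ (Fin d), ℂ)) ξ) := (Lp.memLp h).integrable_mul mk
    have h1 : inner ℝ U v = (∫ ξ, h ξ * conj ((((2 * Real.pi * ‖ξ‖) ^ s : ℝ) : ℂ) *
        (𝓕 Φ : 𝓢(EuclideanSpace ℝ (Fin d), ℂ)) ξ)).re := by
      rw [← (HomSobolev.toL2 d s).inner_map_map, real_inner_comm, hJ, L2.inner_def,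
        ← RCLike.re_to_complex, ← integral_re hi]
      refine integral_congr_ae ?_
      filter_upwards [hJv] with ξ hξ
      rw [hξ, Complex.inner]
      rfl
    -- The weights of exponents `-s` and `s` cancel off the origin, which leaves the unweighted
    -- Parseval identity for `Tₙ` and `φ`.
    have h2 : ∀ n, ∫ ξ, ((((2 * Real.pi * ‖ξ‖) ^ (-s) : ℝ) : ℂ) *
          𝓕 (fun x => (truncate T n x : ℂ)) ξ) * conj ((((2 * Real.pi * ‖ξ‖) ^ s : ℝ) : ℂ) *
        (𝓕 Φ : 𝓢(EuclideanSpace ℝ (Fin d), ℂ)) ξ) = ((∫ x, truncate T n x * φ x : ℝ) : ℂ) := by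
      intro n
      rw [← integral_fourier_mul_conj_fourier_test (integrable_truncate hTl n) hφ hc]
      refine integral_congr_ae ?_
      filter_upwards [ae_ne_zero] with ξ hξ
      have := weight_neg_mul_weight s hξ
      have e : (((2 * Real.pi * ‖ξ‖) ^ (-s) : ℝ) : ℂ) * (((2 * Real.pi * ‖ξ‖) ^ s : ℝ) : ℂ) = 1 := by
        rw [← Complex.ofReal_mul, this, Complex.ofReal_one]
      rw [map_mul, Complex.conj_ofReal]
      linear_combination (𝓕 (fun x => (truncate T n x : ℂ)) ξ *
        conj ((𝓕 Φ : 𝓢(EuclideanSpace ℝ (Fin d), ℂ)) ξ)) * e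
    have h3 := hh _ mk
    have h4 : Tendsto (fun n => ((∫ x, truncate T n x * φ x : ℝ) : ℂ)) atTop
        (nhds (((∫ x, T x * φ x : ℝ) : ℂ))) := by
      refine (Complex.continuous_ofReal.tendsto _).comp ?_
      have iTφ : Integrable fun x => T x * φ x := by
        have := hTl.integrable_smul_right_of_hasCompactSupport hφ.continuous hc
        simpa [mul_comm] using this
      refine tendsto_integral_of_dominated_convergence _ (fun n => ?_) iTφ.norm
        (fun n => Eventually.of_forall fun y => ?_) (Eventually.of_forall fun y => ?_)
      · exact (measurable_truncate hT n).aestronglyMeasurable.mul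
          hφ.continuous.aestronglyMeasurable
      · rw [norm_mul, norm_mul]
        exact mul_le_mul_of_nonneg_right (abs_truncate_le T n y) (norm_nonneg _)
      · exact (tendsto_truncate T y).mul_const _
    have h5 := tendsto_nhds_unique (h3.congr fun n => h2 n) h4
    rw [h1]
    exact (congrArg Complex.re h5).trans (Complex.ofReal_re _)

end limit

end

/-! ### The theorem, assembled from the potential `U`. -/

theorem lemma5p1 (d : ℕ) (hd : 2 ≤ d) (s : ℝ) (hs : 0 < s) (hsd : s < (d : ℝ) / 2)
    (T : EuclideanSpace ℝ (Fin d) → ℝ) (hT : LocallyIntegrable T)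
    (hfin : rieszAbsEnergy (2 * s) T < ⊤) :
    -- the integrals in `I_{2s} * T` and in `𝓓_{2s}(T, T)` converge absolutely
    (∀ᵐ x, Integrable (fun y => rieszKernel d (2 * s) (x - y) * T y)) ∧
    Integrable (fun x => rieszPotential (2 * s) T x * T x) ∧
    -- `T` generates a unique continuous linear functional `L` on the Sobolev space,
    ∃ L : StrongDual ℝ (HomSobolev d s),
      HomSobolev.Extends L T ∧ (∀ L' : StrongDual ℝ (HomSobolev d s), HomSobolev.Extends L' T → L' = L) ∧
      -- it has a unique Riesz representative `U`, and `U = I_{2s} * T` almost everywhere,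
      (∃ U : HomSobolev d s,
        (∀ v, L v = inner ℝ U v) ∧
        (∀ U' : HomSobolev d s, (∀ v, L v = inner ℝ U' v) → U' = U) ∧
        U =ᵐ[volume] rieszPotential (2 * s) T) ∧
      -- and the square of its dual norm is the energy
      ‖L‖ ^ 2 = rieszEnergy (2 * s) T := by
  have : NeZero d := ⟨by omega⟩
  -- The lemmas on potentials assume Borel measurability; passing to a measurable representative
  -- changes none of the integrals.
  obtain ⟨S, hS, hTS⟩ := hT.aestronglyMeasurable.aemeasurable
  have hpot : rieszPotential (2 * s) T = rieszPotential (2 * s) S := by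
    funext x
    refine integral_congr_ae ?_
    filter_upwards [hTS] with y hy
    rw [hy]
  have hen : rieszEnergy (2 * s) T = rieszEnergy (2 * s) S := by
    unfold rieszEnergy
    rw [hpot]
    refine integral_congr_ae ?_
    filter_upwards [hTS] with y hy
    rw [hy]
  have habs : rieszAbsEnergy (2 * s) S < ⊤ := by
    refine lt_of_eq_of_lt ?_ hfin
    have e : ∀ x, ∫⁻ y, ENNReal.ofReal (rieszKernel d (2 * s) (x - y)) * ENNReal.ofReal |S y| =
        ∫⁻ y, ENNReal.ofReal (rieszKernel d (2 * s) (x - y)) * ENNReal.ofReal |T y| := by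
      intro x
      refine lintegral_congr_ae ?_
      filter_upwards [hTS] with y hy
      rw [hy]
    unfold rieszAbsEnergy
    simp_rw [e]
    refine lintegral_congr_ae ?_
    filter_upwards [hTS] with y hy
    rw [hy]
  have hSl : LocallyIntegrable S := hT.congr hTS
  obtain ⟨U, hU, hnorm, hin⟩ := exists_homSobolev_rieszPotential hs hsd hS hSl habs
  have hext : HomSobolev.Extends (innerSL ℝ U) T := by
    intro φ hφ hc
    obtain ⟨v, hv⟩ := HomSobolev.exists_test hs hφ hc
    refine ⟨v, hv, (hin φ hφ hc v hv).trans (integral_congr_ae ?_)⟩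
    filter_upwards [hTS] with y hy
    rw [hy]
  -- Since the functional is the inner product with `U`, the representation is definitional and the
  -- dual norm is `‖U‖`.
  refine ⟨?_, ?_, innerSL ℝ U, hext, fun L' hL' => hext.unique hs hL', ⟨U, fun v => rfl,
    fun U' hU' => HomSobolev.eq_of_inner_eq hs hsd fun w => (hU' w).symm, ?_⟩, ?_⟩
  · filter_upwards [ae_integrable_rieszKernel_mul hs hsd hS habs] with x hx
    refine hx.congr ?_
    filter_upwards [hTS] with y hy
    rw [hy]
  · rw [hpot]
    refine (integrable_rieszPotential_mul hs hsd hS habs).1.congr ?_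
    filter_upwards [hTS] with y hy
    rw [hy]
  · rw [hpot]
    exact hU
  · rw [innerSL_apply_norm, hnorm, hen]
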